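/- **Setting.** Let $Z\subset\mathbb C^n$ be the set of common complex zeros of finitely many polynomials with real (for instance rational) coefficients, of dimension $d\ge 0$, and let $M\in GL(n,\mathbb C)$ have rational entries. Write $\pi_i(x_1,\dots,x_n)=(x_1,\dots,x_i)$. **Definitions.** For an algebraic set $V\subset\mathbb C^n$, let $I(V)\subset\mathbb C[X_1,\dots,X_n]$ be its vanishing ideal, let $\dim V$ be the Krull dimension of $\mathbb C[X_1,\dots,X_n]/I(V)$, and let $\Omega_r(V)$ be the union of the irreducible components of $V$ of dimension $r$. Let $\operatorname{reg}\Omega_r(V)$ be the set of points of $\Omega_r(V)$ at which the Jacobian matrix of generators of $I(\Omega_r(V))$ has rank $n-r$; let $\operatorname{sing}\Omega_r(V)$ be its complement in $\Omega_r(V)$; and let $\operatorname{crit}(\pi_i,\operatorname{reg}\Omega_r(V))$ be the set of points of $\operatorname{reg}\Omega_r(V)$ at which the Jacobian matrix of these generators stacked with that of $\pi_i$ has rank less than $n-r+i$. Put - $\mathscr S(V)=\Omega_0(V)\cup\dots\cup\Omega_{e-1}(V)\cup\operatorname{sing}\Omega_e(V)$, where $e=\dim V$ (and $\mathscr S(\emptyset)=\emptyset$);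 - $\mathscr C(\pi_i,V)$ = the Zariski closure of $\Omega_0(V)\cup\dots\cup\Omega_{i-1}(V)\cup\bigcup_{r\ge i}\operatorname{crit}(\pi_i,\operatorname{reg}\Omega_r(V))$. Define $\mathcal O_d(M^{-1}Z)=M^{-1}Z$ and, for $i=d-1,\dots,0$, $$\mathcal O_i(M^{-1}Z)=\mathscr S(\mathcal O_{i+1}(M^{-1}Z))\cup\mathscr C(\pi_{i+1},\mathcal O_{i+1}(M^{-1}Z))\cup\mathscr C(\pi_{i+1},M^{-1}Z).$$ We say that $M$ satisfies $\mathsf P(Z)$ if for all $i=0,\dots,d$ the set $\mathcal O_i(M^{-1}Z)$ has dimension at most $i$ (the empty set having dimension $-\infty$) and is in Noether position with respect to $X_1,\dots,X_i$, i.e. the natural map $\mathbb C[X_1,\dots,X_i]\to\mathbb C[X_1,\dots,X_n]/I(\mathcal O_i(M^{-1}Z))$ is integral (not necessarily injective). **Proposition.** If $M$ satisfies $\mathsf P(Z)$, then for every $i=1,\dots,d$ and every connected component $C$ of $M^{-1}Z\cap\mathbb R^n$, the boundary of $\pi_i(C)$ in $\mathbb R^i$ (for the Euclidean topology) is contained in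 $\pi_i(\mathcal O_{i-1}(M^{-1}Z)\cap C)$. In particular $\pi_i(C)$ is closed in $\mathbb R^i$. -/

import Mathlib

noncomputable section

namespace PolarProj

open MvPolynomial

/-- `V ⊆ ℂⁿ` is an algebraic set defined over `k` (used with `k = ℂ` and `k = ℝ`): the set of
common complex zeros of an ideal (equivalently, of a finite system) of polynomials over `k`. -/
def IsAlgebraicSet (k : Type) [Field k] [Algebra k ℂ] {n : ℕ} (V : Set (Fin n → ℂ)) : Prop :=
  ∃ I : Ideal (MvPolynomial (Fin n) k), V = zeroLocus ℂ I

/-- The Zariski closure of a subset of `ℂⁿ`. -/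
def zariskiClosure {n : ℕ} (S : Set (Fin n → ℂ)) : Set (Fin n → ℂ) :=
  zeroLocus ℂ (vanishingIdeal ℂ S)

/-- The dimension of an algebraic set: the Krull dimension of its coordinate ring `ℂ[X] / I(V)`.
It is `⊥` exactly for the empty set. -/
def dimension {n : ℕ} (V : Set (Fin n → ℂ)) : WithBot ℕ∞ :=
  ringKrullDim (MvPolynomial (Fin n) ℂ ⧸ vanishingIdeal ℂ V)

/-- Irreducible algebraic sets: nonempty, and not the union of two strictly smaller algebraic
sets. -/
def IsIrreducibleAlgebraic {n : ℕ} (W : Set (Fin n → ℂ)) : Prop :=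
  IsAlgebraicSet ℂ W ∧ W.Nonempty ∧
    ∀ A B : Set (Fin n → ℂ), IsAlgebraicSet ℂ A → IsAlgebraicSet ℂ B →
      W = A ∪ B → W = A ∨ W = B

/-- `W` is an irreducible component of `V`: a maximal irreducible algebraic subset. -/
def IsIrredComponent {n : ℕ} (V W : Set (Fin n → ℂ)) : Prop :=
  Maximal (fun W' => IsIrreducibleAlgebraic W' ∧ W' ⊆ V) W

/-- `Ω_r(V)`: the union of the irreducible components of `V` of dimension `r`. -/
def equidimComponent {n : ℕ} (r : ℕ) (V : Set (Fin n → ℂ)) : Set (Fin n → ℂ) :=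
  {x | ∃ W, IsIrredComponent V W ∧ dimension W = (r : WithBot ℕ∞) ∧ x ∈ W}

/-- The gradient of `p` at `x`, i.e. the row of the Jacobian matrix belonging to `p`. -/
def jacobianRow {n : ℕ} (p : MvPolynomial (Fin n) ℂ) (x : Fin n → ℂ) : Fin n → ℂ :=
  fun k => eval x (pderiv k p)

/-- The row space, at a point `x` of `W`, of the Jacobian matrix of any system of generators of
the ideal `I(W)`; its dimension is the rank of that Jacobian matrix. -/
def jacobianRowSpace {n : ℕ} (W : Set (Fin n → ℂ)) (x : Fin n → ℂ) :
    Submodule ℂ (Fin n → ℂ) :=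
  Submodule.span ℂ ((fun p => jacobianRow p x) '' (vanishingIdeal ℂ W : Set (MvPolynomial (Fin n) ℂ)))

/-- The row space of the (constant) Jacobian matrix of the projection `π_i`. -/
def projRowSpace (n i : ℕ) : Submodule ℂ (Fin n → ℂ) :=
  Submodule.span ℂ {v | ∃ k : Fin n, (k : ℕ) < i ∧ v = Pi.single k 1}

/-- The regular points of an `r`-equidimensional algebraic set `W ⊆ ℂⁿ`: the points where the
Jacobian matrix of generators of `I(W)` has rank `n - r`. -/
def regLocus {n : ℕ} (r : ℕ) (W : Set (Fin n → ℂ)) : Set (Fin n → ℂ) :=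
  {x | x ∈ W ∧ Module.finrank ℂ (jacobianRowSpace W x) + r = n}

/-- The singular points of an `r`-equidimensional algebraic set. -/
def singLocus {n : ℕ} (r : ℕ) (W : Set (Fin n → ℂ)) : Set (Fin n → ℂ) :=
  W \ regLocus r W

/-- `crit(π_i, reg W)` for an `r`-equidimensional `W`: the regular points of `W` where the stacked
Jacobian matrix of generators of `I(W)` and of `π_i` has rank less than `n - r + i`
(all its minors of that size vanish). -/
def critLocus {n : ℕ} (i r : ℕ) (W : Set (Fin n → ℂ)) : Set (Fin n → ℂ) :=
  {x | x ∈ regLocus r W ∧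
    Module.finrank ℂ (jacobianRowSpace W x ⊔ projRowSpace n i : Submodule ℂ (Fin n → ℂ)) + r
      < n + i}

/-- `𝒮(V)`: with `e = dim V`, the union of `Ω_0(V), …, Ω_{e-1}(V)` and of the singular locus
of `Ω_e(V)`. -/
def sLocus {n : ℕ} (V : Set (Fin n → ℂ)) : Set (Fin n → ℂ) :=
  {x | (∃ r : ℕ, (r : WithBot ℕ∞) < dimension V ∧ x ∈ equidimComponent r V) ∨
    (∃ e : ℕ, dimension V = (e : WithBot ℕ∞) ∧ x ∈ singLocus e (equidimComponent e V))}

/-- `𝒞(π_i, V)`: the Zariski closure of the union of `Ω_0(V), …, Ω_{i-1}(V)` and of the sets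
`crit(π_i, reg Ω_r(V))` for `r ≥ i`. -/
def cLocus {n : ℕ} (i : ℕ) (V : Set (Fin n → ℂ)) : Set (Fin n → ℂ) :=
  zariskiClosure
    {x | (∃ r : ℕ, r < i ∧ x ∈ equidimComponent r V) ∨
      (∃ r : ℕ, i ≤ r ∧ x ∈ critLocus i r (equidimComponent r V))}

/-- The sets `𝒪_i(V)` listed downwards: `descending d V k` is `𝒪_{d-k}(V)`. -/
def descending {n : ℕ} (d : ℕ) (V : Set (Fin n → ℂ)) : ℕ → Set (Fin n → ℂ)
  | 0 => V
  | k + 1 => sLocus (descending d V k) ∪ cLocus (d - k) (descending d V k) ∪ cLocus (d - k) V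

/-- The algebraic sets `𝒪_i(V)`, `0 ≤ i ≤ d`, attached to an algebraic set `V` of dimension `d`.
They are characterised by the two lemmas that follow. -/
def oSet {n : ℕ} (d : ℕ) (V : Set (Fin n → ℂ)) (i : ℕ) : Set (Fin n → ℂ) :=
  descending d V (d - i)

theorem oSet_self {n : ℕ} (d : ℕ) (V : Set (Fin n → ℂ)) : oSet d V d = V := by
  simp [oSet, descending]

theorem oSet_of_lt {n : ℕ} (d : ℕ) (V : Set (Fin n → ℂ)) (i : ℕ) (hi : i < d) :
    oSet d V i =
      sLocus (oSet d V (i + 1)) ∪ cLocus (i + 1) (oSet d V (i + 1)) ∪ cLocus (i + 1) V := by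
  have h1 : d - i = (d - (i + 1)) + 1 := by omega
  have h2 : d - (d - (i + 1)) = i + 1 := by omega
  unfold oSet
  rw [h1, descending, h2]

/-- `V` is in Noether position with respect to `X_1, …, X_i`: the coordinate ring `ℂ[X] / I(V)`
is integral over `ℂ[X_1, …, X_i]`, that is, the natural map
`ℂ[X_1, …, X_i] → ℂ[X_1, …, X_n] / I(V)` is integral. -/
def NoetherPosition {n : ℕ} (i : ℕ) (V : Set (Fin n → ℂ)) : Prop :=
  ((Ideal.Quotient.mk (vanishingIdeal ℂ V)).comp
    (rename (R := ℂ) (fun k : {k : Fin n // (k : ℕ) < i} => (k : Fin n))).toRingHom).IsIntegral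

/-- `M⁻¹ V`, the image of `V ⊆ ℂⁿ` under the linear map `M⁻¹`. -/
def invImage {n : ℕ} (M : GL (Fin n) ℂ) (V : Set (Fin n → ℂ)) : Set (Fin n → ℂ) :=
  (fun x => ((M⁻¹ : GL (Fin n) ℂ) : Matrix (Fin n) (Fin n) ℂ).mulVec x) '' V

/-- Property `P(Z)` of a matrix `M`, for an algebraic set `Z` of dimension `d`. -/
def PropertyP {n : ℕ} (d : ℕ) (Z : Set (Fin n → ℂ)) (M : GL (Fin n) ℂ) : Prop :=
  ∀ i : ℕ, i ≤ d →
    dimension (oSet d (invImage M Z) i) ≤ (i : WithBot ℕ∞) ∧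
    NoetherPosition i (oSet d (invImage M Z) i)

/-- `V ∩ ℝⁿ`, as a subset of `ℝⁿ`. -/
def realPoints {n : ℕ} (V : Set (Fin n → ℂ)) : Set (Fin n → ℝ) :=
  {x | (fun k => (x k : ℂ)) ∈ V}

/-- The projection `π_i : ℝⁿ → ℝⁱ` on the first `i` coordinates (`i ≤ n`). -/
def proj {n : ℕ} (i : ℕ) (x : Fin n → ℝ) : {k : Fin n // (k : ℕ) < i} → ℝ :=
  fun k => x k

/-- `C` is a connected component of the subset `S` of `ℝⁿ`. -/
def IsConnectedComponentOf {n : ℕ} (S C : Set (Fin n → ℝ)) : Prop :=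
  ∃ x ∈ S, C = connectedComponentIn S x

/-- Property `Q_i(V)`, for an algebraic set `V` of dimension `d` and `1 ≤ i ≤ d`. -/
def PropertyQ {n : ℕ} (d : ℕ) (V : Set (Fin n → ℂ)) (i : ℕ) : Prop :=
  ∀ C : Set (Fin n → ℝ), IsConnectedComponentOf (realPoints V) C →
    frontier (proj i '' C) ⊆ proj i '' (realPoints (oSet d V (i - 1)) ∩ C)

end PolarProj

end

/-!
Write `V = M⁻¹ Z` and `𝒪_i = 𝒪_i(V)`, and let `C` be a connected component of `V ∩ ℝⁿ`. The
boundary of `π_i(C)` is contained in `π_i(𝒪_i ∩ C)` for all `i ≤ d`, by descending induction on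
`i`, and the theorem is the passage from `𝒪_i` to `𝒪_{i-1}` that the induction step contains.

*From `𝒪_i` to `𝒪_{i-1}`* (`image_proj_mem_nhds`). A point `x` of `𝒪_i ∩ C` outside `𝒪_{i-1}` lies
on a component `K` of dimension `i` of `W = 𝒪_i`, and the gradients of the polynomials vanishing on
the `i`-dimensional part `U` of `W` span `ℂⁿ` together with the differential of `π_i`. Hence `π_i`
is injective on `U` near `x` (`exists_norm_sub_le_of_tangent`). Moreover `π_i` is open on `K`
(`NoetherPosition.exists_mem_of_near`): the coordinate ring of `K` is an integral extension of the
integrally closed ring `ℂ[X_1, …, X_i]`. If `h` is a polynomial that vanishes at `x` and at no other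
point of its fibre, then the constant coefficient of the minimal polynomial of `h` vanishes at
`π_i(x)`; so over points close to `π_i(x)` this polynomial has a small root, which is the value of
`h` at a point of `K`, and by properness this point is close to `x`. Since `U` is stable under
complex conjugation, the unique point of `U` near `x` over a real point is real. So `C` contains a
compact piece that `π_i` maps homeomorphically onto a ball around `π_i(x)`, and `π_i(x)` is not a
boundary point.

*From `i + 1` to `i`* (`frontier_image_subset_of_line`). If the boundary of `π_{i+1}(C)` is
contained in `π_{i+1}(𝒪_i ∩ C)`, then over a point `y` outside the closed set `π_i(𝒪_i ∩ C)` the set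
`π_{i+1}(C)` contains all of the line over `y` or none of it, as a boundary point on that line would
come from `𝒪_i ∩ C`. Near such a `y` the set `π_i(C)` is thus the preimage of `π_{i+1}(C)` under the
section `y ↦ (y, 0)`, and a boundary point of `π_i(C)` would give one of `π_{i+1}(C)` over `y`.

Both steps need `𝒪_i` to be algebraic (`isAlgebraicSet_oSet`). The set `𝒮(W)` is not defined as a
closure, and its algebraicity rests on the bound `n - i` for the Jacobian rank along an
`i`-dimensional component (`finrank_jacobianRowSpace_le`). If the rank were larger, the component
would embed near the point in some `ℂᵐ`, `m < i`, with Lipschitz inverse, although its projection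
contains an open subset of `ℂⁱ`; this is impossible for reasons of Hausdorff dimension.
-/

noncomputable section

namespace PolarProj

open MvPolynomial

variable {n : ℕ}

/-! ### Algebraic sets and their components -/

theorem zariskiClosure_of_isAlgebraicSet {V : Set (Fin n → ℂ)} (hV : IsAlgebraicSet ℂ V) :
    zariskiClosure V = V := by
  obtain ⟨I, rfl⟩ := hV
  exact zeroLocus_vanishingIdeal_galoisConnection.l_u_l_eq_l I

theorem subset_zariskiClosure (S : Set (Fin n → ℂ)) : S ⊆ zariskiClosure S :=
  zeroLocus_vanishingIdeal_le S

theorem isAlgebraicSet_zariskiClosure (S : Set (Fin n → ℂ)) :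
    IsAlgebraicSet ℂ (zariskiClosure S) := ⟨_, rfl⟩

theorem zariskiClosure_mono {S T : Set (Fin n → ℂ)} (h : S ⊆ T) :
    zariskiClosure S ⊆ zariskiClosure T :=
  zeroLocus_anti_mono (vanishingIdeal_anti_mono h)

theorem zariskiClosure_subset {S V : Set (Fin n → ℂ)} (hV : IsAlgebraicSet ℂ V) (h : S ⊆ V) :
    zariskiClosure S ⊆ V :=
  (zariskiClosure_mono h).trans (zariskiClosure_of_isAlgebraicSet hV).subset

theorem isAlgebraicSet_of_zariskiClosure_subset {V : Set (Fin n → ℂ)}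
    (h : zariskiClosure V ⊆ V) : IsAlgebraicSet ℂ V :=
  ⟨_, (subset_zariskiClosure V).antisymm h⟩

theorem IsAlgebraicSet.isClosed {V : Set (Fin n → ℂ)} (hV : IsAlgebraicSet ℂ V) :
    IsClosed V := by
  obtain ⟨I, rfl⟩ := hV
  have : zeroLocus ℂ I = ⋂ p ∈ I, {x : Fin n → ℂ | aeval x p = 0} := by
    ext x; simp
  rw [this]
  refine isClosed_biInter fun p _ => isClosed_eq ?_ continuous_const
  simpa [aeval_eq_eval] using MvPolynomial.continuous_eval p

theorem IsAlgebraicSet.inter {V W : Set (Fin n → ℂ)} (hV : IsAlgebraicSet ℂ V)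
    (hW : IsAlgebraicSet ℂ W) : IsAlgebraicSet ℂ (V ∩ W) :=
  isAlgebraicSet_of_zariskiClosure_subset <| Set.subset_inter
    (zariskiClosure_subset hV Set.inter_subset_left)
    (zariskiClosure_subset hW Set.inter_subset_right)

theorem IsAlgebraicSet.union {V W : Set (Fin n → ℂ)} (hV : IsAlgebraicSet ℂ V)
    (hW : IsAlgebraicSet ℂ W) : IsAlgebraicSet ℂ (V ∪ W) := by
  obtain ⟨I, rfl⟩ := hV
  obtain ⟨J, rfl⟩ := hW
  refine ⟨I * J, Set.Subset.antisymm ?_ ?_⟩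
  · rintro x (hx | hx) p hp
    · exact hx p ((Ideal.mul_le_left (I := I) (J := J)) hp)
    · exact hx p ((Ideal.mul_le_right (I := I) (J := J)) hp)
  · intro x hx
    by_contra hcon
    simp only [Set.mem_union, not_or, mem_zeroLocus_iff, not_forall] at hcon
    obtain ⟨⟨p, hp, hpx⟩, ⟨q, hq, hqx⟩⟩ := hcon
    have := hx _ (Ideal.mul_mem_mul hp hq)
    rw [map_mul] at this
    exact (mul_ne_zero hpx hqx) this

theorem isAlgebraicSet_empty : IsAlgebraicSet ℂ (∅ : Set (Fin n → ℂ)) :=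
  ⟨⊤, by simp⟩

theorem isAlgebraicSet_biUnion {ι : Type*} {s : Set ι} (hs : s.Finite)
    {f : ι → Set (Fin n → ℂ)} (hf : ∀ i ∈ s, IsAlgebraicSet ℂ (f i)) :
    IsAlgebraicSet ℂ (⋃ i ∈ s, f i) := by
  induction s, hs using Set.Finite.induction_on with
  | empty => simpa using isAlgebraicSet_empty
  | insert _ _ ih =>
    rw [Set.biUnion_insert]
    exact (hf _ (Set.mem_insert _ _)).union (ih fun i hi => hf i (Set.mem_insert_of_mem _ hi))

theorem IsIrreducibleAlgebraic.isPrime {W : Set (Fin n → ℂ)} (hW : IsIrreducibleAlgebraic W) :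
    (vanishingIdeal ℂ W).IsPrime := by
  obtain ⟨hWa, ⟨x, hx⟩, hirr⟩ := hW
  refine ⟨fun h => ?_, fun {p q} hpq => ?_⟩
  · have h1 : (1 : MvPolynomial (Fin n) ℂ) ∈ vanishingIdeal ℂ W := h ▸ Submodule.mem_top
    simpa using h1 x hx
  · have hsplit : W = (W ∩ zeroLocus ℂ (Ideal.span {p})) ∪ (W ∩ zeroLocus ℂ (Ideal.span {q})) := by
      ext y
      simp only [zeroLocus_span, Set.mem_singleton_iff, forall_eq, Set.mem_union, Set.mem_inter_iff,
        Set.mem_ofPred_eq]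
      refine ⟨fun hy => ?_, fun h => h.elim And.left And.left⟩
      have := hpq y hy
      rw [map_mul, mul_eq_zero] at this
      exact this.imp (⟨hy, ·⟩) (⟨hy, ·⟩)
    rcases hirr _ _ (hWa.inter ⟨_, rfl⟩) (hWa.inter ⟨_, rfl⟩) hsplit with h | h
    · left
      intro y hy
      have := (h.subset hy).2
      simpa [zeroLocus_span] using this
    · right
      intro y hy
      have := (h.subset hy).2
      simpa [zeroLocus_span] using this

theorem isIrreducibleAlgebraic_zeroLocus (P : Ideal (MvPolynomial (Fin n) ℂ)) [hP : P.IsPrime] :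
    IsIrreducibleAlgebraic (zeroLocus ℂ P) := by
  refine ⟨⟨P, rfl⟩, ?_, fun A B hA hB h => ?_⟩
  · by_contra hne
    rw [Set.not_nonempty_iff_eq_empty] at hne
    have := IsPrime.vanishingIdeal_zeroLocus (K := ℂ) P
    rw [hne, vanishingIdeal_empty] at this
    exact hP.ne_top this.symm
  · have hle : vanishingIdeal ℂ A * vanishingIdeal ℂ B ≤ P := by
      rw [← IsPrime.vanishingIdeal_zeroLocus (K := ℂ) P, h]
      rintro p hp x (hx | hx)
      · exact Ideal.mul_le_left (I := vanishingIdeal ℂ A) hp x hx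
      · exact Ideal.mul_le_right (J := vanishingIdeal ℂ B) hp x hx
    rcases hP.mul_le.mp hle with h' | h'
    · left
      refine Set.Subset.antisymm ?_ (h ▸ Set.subset_union_left)
      exact (zeroLocus_anti_mono h').trans (zariskiClosure_of_isAlgebraicSet hA).subset
    · right
      refine Set.Subset.antisymm ?_ (h ▸ Set.subset_union_right)
      exact (zeroLocus_anti_mono h').trans (zariskiClosure_of_isAlgebraicSet hB).subset

/-- Each point of an algebraic set `V` lies on a component: a prime minimal over `I(V)` and
contained in the maximal ideal of the point defines one. -/
theorem exists_isIrredComponent_mem {V : Set (Fin n → ℂ)} (hV : IsAlgebraicSet ℂ V)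
    {x : Fin n → ℂ} (hx : x ∈ V) : ∃ W, IsIrredComponent V W ∧ x ∈ W := by
  have hle : vanishingIdeal ℂ V ≤ vanishingIdeal ℂ {x} :=
    vanishingIdeal_anti_mono (Set.singleton_subset_iff.2 hx)
  obtain ⟨P, hP, hPx⟩ := Ideal.exists_minimalPrimes_le hle
  have hPp : P.IsPrime := hP.1.1
  refine ⟨zeroLocus ℂ P, ⟨⟨isIrreducibleAlgebraic_zeroLocus P, ?_⟩, ?_⟩, fun p hp => hPx hp x rfl⟩
  · exact (zeroLocus_anti_mono hP.1.2).trans (zariskiClosure_of_isAlgebraicSet hV).subset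
  · rintro W' ⟨hW', hW'V⟩ hPW
    have h1 : vanishingIdeal ℂ W' ≤ P := by
      rw [← IsPrime.vanishingIdeal_zeroLocus (K := ℂ) P]
      exact vanishingIdeal_anti_mono hPW
    have h2 : P ≤ vanishingIdeal ℂ W' :=
      hP.2 ⟨hW'.isPrime, vanishingIdeal_anti_mono hW'V⟩ h1
    exact (subset_zariskiClosure W').trans (zeroLocus_anti_mono h2)

theorem IsIrredComponent.vanishingIdeal_mem_minimalPrimes {V W : Set (Fin n → ℂ)}
    (hV : IsAlgebraicSet ℂ V) (hW : IsIrredComponent V W) :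
    vanishingIdeal ℂ W ∈ (vanishingIdeal ℂ V).minimalPrimes := by
  refine ⟨⟨hW.1.1.isPrime, vanishingIdeal_anti_mono hW.1.2⟩, ?_⟩
  rintro Q ⟨hQ, hVQ⟩ hQW
  have h1 : W ⊆ zeroLocus ℂ Q := (subset_zariskiClosure W).trans (zeroLocus_anti_mono hQW)
  have h2 : zeroLocus ℂ Q ⊆ V :=
    (zeroLocus_anti_mono hVQ).trans (zariskiClosure_of_isAlgebraicSet hV).subset
  have h3 := hW.2 ⟨isIrreducibleAlgebraic_zeroLocus Q, h2⟩ h1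
  rw [← IsPrime.vanishingIdeal_zeroLocus (K := ℂ) Q]
  exact vanishingIdeal_anti_mono h3

theorem finite_isIrredComponent {V : Set (Fin n → ℂ)} (hV : IsAlgebraicSet ℂ V) :
    {W | IsIrredComponent V W}.Finite := by
  refine ((Ideal.finite_minimalPrimes_of_isNoetherianRing _ (vanishingIdeal ℂ V)).image
    (fun P => zeroLocus ℂ P)).subset fun W hW => ?_
  exact ⟨_, hW.vanishingIdeal_mem_minimalPrimes hV, zariskiClosure_of_isAlgebraicSet hW.1.1.1⟩

theorem isAlgebraicSet_equidimComponent {V : Set (Fin n → ℂ)} (hV : IsAlgebraicSet ℂ V) (r : ℕ) :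
    IsAlgebraicSet ℂ (equidimComponent r V) := by
  have h : equidimComponent r V =
      ⋃ W ∈ {W | IsIrredComponent V W ∧ dimension W = (r : WithBot ℕ∞)}, W := by
    ext x; simp [equidimComponent, and_assoc]
  rw [h]
  exact isAlgebraicSet_biUnion ((finite_isIrredComponent hV).subset fun W hW => hW.1)
    fun W hW => hW.1.1.1.1

theorem equidimComponent_subset (r : ℕ) (V : Set (Fin n → ℂ)) : equidimComponent r V ⊆ V := by
  rintro x ⟨W, hW, -, hx⟩
  exact hW.1.2 hx

theorem dimension_mono {A B : Set (Fin n → ℂ)} (h : A ⊆ B) : dimension A ≤ dimension B :=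
  ringKrullDim_le_of_surjective (Ideal.Quotient.factor (vanishingIdeal_anti_mono h))
    (Ideal.Quotient.factor_surjective _)

theorem dimension_nonneg {A : Set (Fin n → ℂ)} (h : A.Nonempty) : 0 ≤ dimension A := by
  obtain ⟨x, hx⟩ := h
  have : Nontrivial (MvPolynomial (Fin n) ℂ ⧸ vanishingIdeal ℂ A) := by
    refine Ideal.Quotient.nontrivial_iff.2 fun h => ?_
    have h1 : (1 : MvPolynomial (Fin n) ℂ) ∈ vanishingIdeal ℂ A := h ▸ Submodule.mem_top
    simpa using h1 x hx
  exact ringKrullDim_nonneg_of_nontrivial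

/-- Each point of an algebraic set of dimension at most `i` lies on a component of some
dimension `r ≤ i`. -/
theorem exists_mem_equidimComponent {V : Set (Fin n → ℂ)} (hV : IsAlgebraicSet ℂ V) {i : ℕ}
    (hd : dimension V ≤ (i : WithBot ℕ∞)) {x : Fin n → ℂ} (hx : x ∈ V) :
    ∃ r ≤ i, x ∈ equidimComponent r V := by
  obtain ⟨W, hW, hxW⟩ := exists_isIrredComponent_mem hV hx
  have h0 := dimension_nonneg ⟨x, hxW⟩
  have h1 := (dimension_mono hW.1.2).trans hd
  obtain ⟨r, hr⟩ : ∃ r : ℕ, dimension W = (r : WithBot ℕ∞) := by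
    generalize dimension W = D at h0 h1
    induction D using WithBot.recBotCoe with
    | bot => simp at h0
    | coe D =>
      induction D using ENat.recTopCoe with
      | top => exact absurd (WithBot.coe_le_coe.1 h1) (by simp)
      | coe r => exact ⟨r, rfl⟩
  refine ⟨r, ?_, W, hW, hr, hxW⟩
  rw [hr] at h1
  exact_mod_cast h1

/-! ### Complex conjugation -/

/-- The complex conjugate of a subset of `ℂⁿ`. -/
def conjSet (S : Set (Fin n → ℂ)) : Set (Fin n → ℂ) := {x | star x ∈ S}

/-- Conjugation of the coefficients of a polynomial. -/
def conjPoly (n : ℕ) : MvPolynomial (Fin n) ℂ ≃+* MvPolynomial (Fin n) ℂ :=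
  MvPolynomial.mapEquiv (Fin n) (starRingAut : ℂ ≃+* ℂ)

@[simp]
theorem mem_conjSet {S : Set (Fin n → ℂ)} {x : Fin n → ℂ} : x ∈ conjSet S ↔ star x ∈ S := Iff.rfl

@[simp]
theorem conjSet_conjSet (S : Set (Fin n → ℂ)) : conjSet (conjSet S) = S := by
  ext x; simp

theorem conjSet_subset_iff {S T : Set (Fin n → ℂ)} : conjSet S ⊆ T ↔ S ⊆ conjSet T := by
  refine ⟨fun h x hx => h (by simpa using hx), fun h x hx => by simpa using h hx⟩

theorem conjSet_union (S T : Set (Fin n → ℂ)) : conjSet (S ∪ T) = conjSet S ∪ conjSet T := rfl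

theorem eval_conjPoly (p : MvPolynomial (Fin n) ℂ) (x : Fin n → ℂ) :
    eval x (conjPoly n p) = star (eval (star x) p) := by
  have h : (eval x).comp (conjPoly n : _ →+* MvPolynomial (Fin n) ℂ) =
      (starRingEnd ℂ).comp (eval (star x)) := by
    apply MvPolynomial.ringHom_ext
    · intro r; simp [conjPoly, starRingAut]
    · intro k; simp [conjPoly]
  exact RingHom.congr_fun h p

theorem vanishingIdeal_conjSet (S : Set (Fin n → ℂ)) :
    vanishingIdeal ℂ (conjSet S) = (vanishingIdeal ℂ S).comap (conjPoly n) := by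
  ext p
  simp only [mem_vanishingIdeal_iff, mem_conjSet, Ideal.mem_comap, aeval_eq_eval, eval_conjPoly]
  constructor
  · intro h x hx
    simpa using h (star x) (by simpa using hx)
  · intro h x hx
    simpa using h (star x) hx

theorem conjSet_zeroLocus (I : Ideal (MvPolynomial (Fin n) ℂ)) :
    conjSet (zeroLocus ℂ I) = zeroLocus ℂ (I.comap (conjPoly n)) := by
  ext x
  simp only [mem_zeroLocus_iff, mem_conjSet, Ideal.mem_comap, aeval_eq_eval]
  constructor
  · intro h p hp
    have := h _ hp
    rw [eval_conjPoly] at this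
    simpa using this
  · intro h p hp
    have := h ((conjPoly n).symm p) (by simpa using hp)
    rw [← RingEquiv.apply_symm_apply (conjPoly n) p, eval_conjPoly]
    simpa using this

theorem IsAlgebraicSet.conjSet {V : Set (Fin n → ℂ)} (hV : IsAlgebraicSet ℂ V) :
    IsAlgebraicSet ℂ (conjSet V) := by
  obtain ⟨I, rfl⟩ := hV
  exact ⟨_, conjSet_zeroLocus I⟩

theorem zariskiClosure_conjSet (S : Set (Fin n → ℂ)) :
    zariskiClosure (conjSet S) = conjSet (zariskiClosure S) := by
  rw [zariskiClosure, zariskiClosure, conjSet_zeroLocus, vanishingIdeal_conjSet]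

theorem dimension_conjSet (S : Set (Fin n → ℂ)) : dimension (conjSet S) = dimension S := by
  refine ringKrullDim_eq_of_ringEquiv (Ideal.quotientEquiv _ _ (conjPoly n) ?_)
  rw [vanishingIdeal_conjSet]
  ext p
  refine Iff.trans ?_ (Ideal.mem_map_iff_of_surjective
    (conjPoly n : MvPolynomial (Fin n) ℂ →+* MvPolynomial (Fin n) ℂ)
    (conjPoly n).surjective).symm
  constructor
  · intro hp
    refine ⟨(conjPoly n).symm p, ?_, by simp⟩
    change conjPoly n ((conjPoly n).symm p) ∈ vanishingIdeal ℂ S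
    rwa [RingEquiv.apply_symm_apply]
  · rintro ⟨q, hq, rfl⟩
    exact hq

theorem IsIrreducibleAlgebraic.conjSet {W : Set (Fin n → ℂ)} (hW : IsIrreducibleAlgebraic W) :
    IsIrreducibleAlgebraic (conjSet W) := by
  obtain ⟨hWa, ⟨x, hx⟩, h⟩ := hW
  refine ⟨hWa.conjSet, ⟨star x, by simpa using hx⟩, fun A B hA hB hAB => ?_⟩
  refine (h _ _ hA.conjSet hB.conjSet ?_).imp ?_ ?_
  · rw [← conjSet_union, ← hAB, conjSet_conjSet]
  · rintro rfl; simp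
  · rintro rfl; simp

theorem IsIrredComponent.conjSet {V W : Set (Fin n → ℂ)} (hW : IsIrredComponent V W) :
    IsIrredComponent (conjSet V) (conjSet W) := by
  refine ⟨⟨hW.1.1.conjSet, fun x hx => hW.1.2 hx⟩, ?_⟩
  rintro W' ⟨hW', hW'V⟩ hle
  have h := hW.2 (y := PolarProj.conjSet W') ⟨hW'.conjSet, conjSet_subset_iff.2 hW'V⟩
    (conjSet_subset_iff.1 hle)
  exact conjSet_subset_iff.1 h

theorem equidimComponent_conjSet (r : ℕ) (V : Set (Fin n → ℂ)) :
    equidimComponent r (conjSet V) = conjSet (equidimComponent r V) := by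
  ext x
  constructor
  · rintro ⟨W, hW, hd, hx⟩
    exact ⟨conjSet W, by simpa using hW.conjSet, by rw [dimension_conjSet, hd], by simpa using hx⟩
  · rintro ⟨W, hW, hd, hx⟩
    exact ⟨conjSet W, hW.conjSet, by rw [dimension_conjSet, hd], hx⟩

theorem jacobianRow_conjPoly (p : MvPolynomial (Fin n) ℂ) (x : Fin n → ℂ) :
    jacobianRow (conjPoly n p) x = star (jacobianRow p (star x)) := by
  ext k
  have : pderiv k (conjPoly n p) = conjPoly n (pderiv k p) := by
    simp [conjPoly, MvPolynomial.pderiv_map]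
  simp only [jacobianRow, this, eval_conjPoly, Pi.star_apply]

theorem finrank_map_star (S : Submodule ℂ (Fin n → ℂ)) :
    Module.finrank ℂ (S.map (starLinearEquiv ℂ (A := Fin n → ℂ)).toLinearMap) =
      Module.finrank ℂ S := by
  let e : S ≃ₛₗ[starRingEnd ℂ] S.map (starLinearEquiv ℂ (A := Fin n → ℂ)).toLinearMap :=
    (starLinearEquiv ℂ (A := Fin n → ℂ)).submoduleMap S
  have := rank_eq_of_equiv_equiv (starRingEnd ℂ) e.toAddEquiv
    (star_involutive.bijective) (fun r m => e.map_smulₛₗ r m)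
  simp only [Module.finrank, this]

theorem jacobianRowSpace_conjSet (W : Set (Fin n → ℂ)) (x : Fin n → ℂ) :
    jacobianRowSpace (conjSet W) x =
      (jacobianRowSpace W (star x)).map (starLinearEquiv ℂ (A := Fin n → ℂ)).toLinearMap := by
  rw [jacobianRowSpace, jacobianRowSpace, Submodule.map_span]
  congr 1
  ext v
  simp only [Set.mem_image, SetLike.mem_coe, vanishingIdeal_conjSet, Ideal.mem_comap]
  constructor
  · rintro ⟨p, hp, rfl⟩
    exact ⟨_, ⟨_, hp, rfl⟩, by simp [jacobianRow_conjPoly]⟩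
  · rintro ⟨_, ⟨p, hp, rfl⟩, rfl⟩
    refine ⟨(conjPoly n).symm p, by simpa using hp, ?_⟩
    conv_rhs => rw [← RingEquiv.apply_symm_apply (conjPoly n) p, jacobianRow_conjPoly]
    simp

theorem map_star_projRowSpace (n i : ℕ) :
    (projRowSpace n i).map (starLinearEquiv ℂ (A := Fin n → ℂ)).toLinearMap =
      projRowSpace n i := by
  rw [projRowSpace, Submodule.map_span]
  congr 1
  ext v
  simp only [Set.mem_image, Set.mem_ofPred_eq]
  have h (k : Fin n) : star (Pi.single k (1 : ℂ) : Fin n → ℂ) = Pi.single k 1 := by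
    rw [← Pi.single_star, star_one]
  constructor
  · rintro ⟨_, ⟨k, hk, rfl⟩, rfl⟩
    exact ⟨k, hk, h k⟩
  · rintro ⟨k, hk, rfl⟩
    exact ⟨_, ⟨k, hk, rfl⟩, h k⟩

theorem regLocus_conjSet (r : ℕ) (W : Set (Fin n → ℂ)) :
    regLocus r (conjSet W) = conjSet (regLocus r W) := by
  ext x
  have h : Module.finrank ℂ (jacobianRowSpace (conjSet W) x) =
      Module.finrank ℂ (jacobianRowSpace W (star x)) := by
    rw [jacobianRowSpace_conjSet, finrank_map_star]
  simp only [regLocus, Set.mem_ofPred_eq, mem_conjSet, h]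

theorem singLocus_conjSet (r : ℕ) (W : Set (Fin n → ℂ)) :
    singLocus r (conjSet W) = conjSet (singLocus r W) := by
  rw [singLocus, singLocus, regLocus_conjSet]; rfl

theorem critLocus_conjSet (i r : ℕ) (W : Set (Fin n → ℂ)) :
    critLocus i r (conjSet W) = conjSet (critLocus i r W) := by
  ext x
  rw [critLocus, critLocus, regLocus_conjSet]
  simp only [Set.mem_ofPred_eq, mem_conjSet]
  rw [jacobianRowSpace_conjSet, ← map_star_projRowSpace n i, ← Submodule.map_sup,
    finrank_map_star, map_star_projRowSpace n i]

theorem sLocus_conjSet (V : Set (Fin n → ℂ)) : sLocus (conjSet V) = conjSet (sLocus V) := by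
  ext x
  simp only [sLocus, Set.mem_ofPred_eq, mem_conjSet, dimension_conjSet, equidimComponent_conjSet,
    singLocus_conjSet]

theorem cLocus_conjSet (i : ℕ) (V : Set (Fin n → ℂ)) :
    cLocus i (conjSet V) = conjSet (cLocus i V) := by
  rw [cLocus, cLocus, ← zariskiClosure_conjSet]
  congr 1
  ext x
  simp only [Set.mem_ofPred_eq, mem_conjSet, equidimComponent_conjSet, critLocus_conjSet]

theorem descending_conjSet (d : ℕ) (V : Set (Fin n → ℂ)) (k : ℕ) :
    descending d (conjSet V) k = conjSet (descending d V k) := by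
  induction k with
  | zero => rfl
  | succ k ih =>
    simp only [descending, ih, sLocus_conjSet, cLocus_conjSet, conjSet_union]

theorem oSet_conjSet (d : ℕ) (V : Set (Fin n → ℂ)) (i : ℕ) :
    oSet d (conjSet V) i = conjSet (oSet d V i) :=
  descending_conjSet d V _

/-! ### Noether position: properness and openness of the projection -/

/-- The complex projection `π_i : ℂⁿ → ℂⁱ`. -/
def projC {n : ℕ} (i : ℕ) (x : Fin n → ℂ) : {k : Fin n // (k : ℕ) < i} → ℂ := fun k => x k

theorem continuous_projC (i : ℕ) : Continuous (projC (n := n) i) := by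
  unfold projC; fun_prop

/-- The structure map `ℂ[X_1, …, X_i] → ℂ[X_1, …, X_n] / I(V)`. -/
def noetherMap (i : ℕ) (V : Set (Fin n → ℂ)) :
    MvPolynomial {k : Fin n // (k : ℕ) < i} ℂ →+* MvPolynomial (Fin n) ℂ ⧸ vanishingIdeal ℂ V :=
  (Ideal.Quotient.mk (vanishingIdeal ℂ V)).comp
    (rename (R := ℂ) (fun k : {k : Fin n // (k : ℕ) < i} => (k : Fin n))).toRingHom

/-- Evaluation at a point of `V`, on the coordinate ring of `V`. -/
def evalPoint {V : Set (Fin n → ℂ)} {x : Fin n → ℂ} (hx : x ∈ V) :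
    MvPolynomial (Fin n) ℂ ⧸ vanishingIdeal ℂ V →+* ℂ :=
  Ideal.Quotient.lift _ (eval x) fun p hp => by simpa [aeval_eq_eval] using hp x hx

theorem evalPoint_mk {V : Set (Fin n → ℂ)} {x : Fin n → ℂ} (hx : x ∈ V)
    (p : MvPolynomial (Fin n) ℂ) : evalPoint hx (Ideal.Quotient.mk _ p) = eval x p := rfl

theorem evalPoint_comp_noetherMap (i : ℕ) {V : Set (Fin n → ℂ)} {x : Fin n → ℂ} (hx : x ∈ V) :
    (evalPoint hx).comp (noetherMap i V) = eval (projC i x) := by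
  ext k
  · simp [noetherMap, evalPoint_mk]
  · simp [noetherMap, evalPoint_mk, projC]

/-- A polynomial relation in the coordinate ring specialises to each point. -/
theorem isRoot_map_of_eval₂_eq_zero {i : ℕ} {V : Set (Fin n → ℂ)}
    {q : Polynomial (MvPolynomial {k : Fin n // (k : ℕ) < i} ℂ)} {h : MvPolynomial (Fin n) ℂ}
    (hq : q.eval₂ (noetherMap i V) (Ideal.Quotient.mk _ h) = 0) {x : Fin n → ℂ} (hx : x ∈ V) :
    (q.map (eval (projC i x))).IsRoot (eval x h) := by
  have := congrArg (evalPoint hx) hq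
  rw [Polynomial.hom_eval₂, evalPoint_comp_noetherMap, evalPoint_mk, map_zero] at this
  rwa [Polynomial.IsRoot, Polynomial.eval_map]

/-- On a set in Noether position each coordinate is a root of a monic polynomial whose
coefficients depend on the first `i` coordinates only. -/
theorem NoetherPosition.exists_monic {i : ℕ} {V : Set (Fin n → ℂ)} (hV : NoetherPosition i V)
    (j : Fin n) : ∃ q : Polynomial (MvPolynomial {k : Fin n // (k : ℕ) < i} ℂ), q.Monic ∧
      ∀ x ∈ V, (q.map (eval (projC i x))).IsRoot (x j) := by
  obtain ⟨q, hq, h⟩ := hV (Ideal.Quotient.mk _ (X j))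
  exact ⟨q, hq, fun x hx => by simpa using isRoot_map_of_eval₂_eq_zero h hx⟩

theorem NoetherPosition.mono {i : ℕ} {V W : Set (Fin n → ℂ)} (hV : NoetherPosition i V)
    (h : W ⊆ V) : NoetherPosition i W := by
  have hle : vanishingIdeal ℂ V ≤ vanishingIdeal ℂ W := vanishingIdeal_anti_mono h
  intro b
  obtain ⟨p, rfl⟩ := Ideal.Quotient.mk_surjective b
  obtain ⟨q, hq, hz⟩ := hV (Ideal.Quotient.mk _ p)
  refine ⟨q, hq, ?_⟩
  have := congrArg (Ideal.Quotient.factor hle) hz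
  rw [Polynomial.hom_eval₂, map_zero] at this
  exact this

/-- The projection of a set in Noether position is proper: points over bounded sets are
bounded. -/
theorem NoetherPosition.exists_norm_le {i : ℕ} {V : Set (Fin n → ℂ)} (hV : NoetherPosition i V)
    (R : ℝ) : ∃ B : ℝ, ∀ x ∈ V, ‖projC i x‖ ≤ R → ‖x‖ ≤ B := by
  have key : ∀ j : Fin n, ∃ B : ℝ, ∀ x ∈ V, ‖projC i x‖ ≤ R → ‖x j‖ ≤ B := by
    intro j
    obtain ⟨q, hq, hroot⟩ := hV.exists_monic j
    have hcont : Continuous fun y : {k : Fin n // (k : ℕ) < i} → ℂ =>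
        (((Finset.range q.natDegree).sup fun l => ‖eval y (q.coeff l)‖₊ : NNReal) : ℝ) := by
      exact NNReal.continuous_coe.comp (Continuous.finset_sup_apply fun l _ =>
        (MvPolynomial.continuous_eval _).nnnorm)
    obtain ⟨B, hB⟩ := (isCompact_closedBall (0 : {k : Fin n // (k : ℕ) < i} → ℂ)
      R).exists_bound_of_continuousOn hcont.continuousOn
    refine ⟨B + 1, fun x hx hxR => ?_⟩
    have hm := hq.map (eval (projC i x))
    have h1 := (hroot x hx).norm_lt_cauchyBound hm.ne_zero
    have h2 := hB (projC i x) (by simpa using hxR)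
    rw [Polynomial.cauchyBound, hm.leadingCoeff, hq.natDegree_map] at h1
    simp only [Polynomial.coeff_map, nnnorm_one, div_one] at h1
    have h3 := NNReal.coe_lt_coe.2 h1
    rw [NNReal.coe_add] at h3
    rw [Real.norm_of_nonneg (NNReal.coe_nonneg _)] at h2
    simp only [coe_nnnorm, NNReal.coe_one] at h3
    linarith
  choose B hB using key
  refine ⟨∑ j, |B j|, fun x hx hxR => ?_⟩
  refine (pi_norm_le_iff_of_nonneg (Finset.sum_nonneg fun j _ => abs_nonneg _)).2 fun j => ?_
  exact ((hB j x hx hxR).trans (le_abs_self _)).trans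
    (Finset.single_le_sum (f := fun j => |B j|) (fun j _ => abs_nonneg _) (Finset.mem_univ j))

theorem NoetherPosition.finite_fiber {i : ℕ} {V : Set (Fin n → ℂ)} (hV : NoetherPosition i V)
    (y : {k : Fin n // (k : ℕ) < i} → ℂ) : {x ∈ V | projC i x = y}.Finite := by
  choose q hq hroot using hV.exists_monic
  refine (Set.Finite.pi' (ι := Fin n) (t := fun j => {t | (((q j).map (eval y)).IsRoot t)})
    fun j => ?_).subset ?_
  · exact Polynomial.finite_setOfPred_isRoot ((hq j).map _).ne_zero
  · rintro x ⟨hx, rfl⟩ j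
    exact hroot j x hx

/-- Incomparability for integral extensions, as a statement on spectra. -/
theorem comap_strictMono_of_isIntegral {A B : Type*} [CommRing A] [CommRing B] {f : A →+* B}
    (hf : f.IsIntegral) : StrictMono (PrimeSpectrum.comap f) := by
  algebraize [f]
  intro P Q hPQ
  exact Ideal.IsIntegral.comap_lt_comap (R := A) hPQ

/-- If `V` has the largest dimension that Noether position allows, then `π_i` is dominant on
`V`. -/
theorem NoetherPosition.injective {i : ℕ} {V : Set (Fin n → ℂ)} (hV : NoetherPosition i V)
    (hd : (i : WithBot ℕ∞) ≤ dimension V) : Function.Injective (noetherMap i V) := by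
  rw [injective_iff_map_eq_zero]
  intro a ha
  by_contra hne
  let g := Ideal.Quotient.lift (Ideal.span {a}) (noetherMap i V) (by
    intro b hb
    obtain ⟨c, rfl⟩ := Ideal.mem_span_singleton.1 hb
    rw [map_mul, ha, zero_mul])
  have hg : g.IsIntegral := by
    refine RingHom.IsIntegral.tower_top (Ideal.Quotient.mk (Ideal.span {a})) g ?_
    have : g.comp (Ideal.Quotient.mk (Ideal.span {a})) = noetherMap i V :=
      Ideal.Quotient.lift_comp_mk ..
    rw [this]
    exact hV
  have h1 : dimension V ≤
      ringKrullDim (MvPolynomial {k : Fin n // (k : ℕ) < i} ℂ ⧸ Ideal.span {a}) :=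
    Order.krullDim_le_of_strictMono _ (comap_strictMono_of_isIntegral hg)
  have h2 := ringKrullDim_quotient_succ_le_of_nonZeroDivisor (mem_nonZeroDivisors_of_ne_zero hne)
  rw [MvPolynomial.ringKrullDim_of_isNoetherianRing, ringKrullDim_eq_zero_of_field, zero_add] at h2
  have hcard : Nat.card {k : Fin n // (k : ℕ) < i} ≤ i := by
    have := Nat.card_le_card_of_injective
      (fun k : {k : Fin n // (k : ℕ) < i} => (⟨(k : Fin n), k.2⟩ : Fin i))
      (fun k l h => Subtype.ext (Fin.ext (by simpa using h)))
    simpa using this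
  have h3 : (i : WithBot ℕ∞) + 1 ≤ (i : WithBot ℕ∞) := by
    calc (i : WithBot ℕ∞) + 1 ≤ dimension V + 1 := by gcongr
      _ ≤ _ := by gcongr
      _ ≤ _ := h2
      _ ≤ i := by exact_mod_cast hcard
  have : i + 1 ≤ i := by exact_mod_cast h3
  omega

/-- The minimal polynomial of `h` over `ℂ[X_1, …, X_i]`, specialised at `y`, has as its roots
exactly the values of `h` on the fibre of `π_i` over `y`. Integral closedness of the polynomial
ring makes it generate the relations of `h`, and lying over lifts each root to a point. -/
theorem NoetherPosition.exists_monic_roots_eq {i : ℕ} {K : Set (Fin n → ℂ)}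
    (hK : IsIrreducibleAlgebraic K) (hN : NoetherPosition i K)
    (hd : (i : WithBot ℕ∞) ≤ dimension K) (h : MvPolynomial (Fin n) ℂ) :
    ∃ p : Polynomial (MvPolynomial {k : Fin n // (k : ℕ) < i} ℂ), p.Monic ∧
      (∀ x ∈ K, (p.map (eval (projC i x))).IsRoot (eval x h)) ∧
      ∀ y t, (p.map (eval y)).IsRoot t → ∃ z ∈ K, projC i z = y ∧ eval z h = t := by
  have hinj := hN.injective hd
  have hprime := hK.isPrime
  let : Algebra (MvPolynomial {k : Fin n // (k : ℕ) < i} ℂ)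
    (MvPolynomial (Fin n) ℂ ⧸ vanishingIdeal ℂ K) := (noetherMap i K).toAlgebra
  have : FaithfulSMul (MvPolynomial {k : Fin n // (k : ℕ) < i} ℂ)
    (MvPolynomial (Fin n) ℂ ⧸ vanishingIdeal ℂ K) :=
    (faithfulSMul_iff_algebraMap_injective _ _).2 hinj
  let b : MvPolynomial (Fin n) ℂ ⧸ vanishingIdeal ℂ K := Ideal.Quotient.mk _ h
  have hbint : IsIntegral (MvPolynomial {k : Fin n // (k : ℕ) < i} ℂ) b := hN b
  let p := minpoly (MvPolynomial {k : Fin n // (k : ℕ) < i} ℂ) b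
  have hp0 : p.eval₂ (noetherMap i K) b = 0 := minpoly.aeval _ b
  refine ⟨p, minpoly.monic hbint, fun x hx => isRoot_map_of_eval₂_eq_zero hp0 hx,
    fun y t ht => ?_⟩
  -- `ℂ[X_1, …, X_i][h]`, embedded in the coordinate ring; `(y, t)` is a point of its spectrum
  let g : AdjoinRoot p →+* MvPolynomial (Fin n) ℂ ⧸ vanishingIdeal ℂ K :=
    AdjoinRoot.lift (noetherMap i K) b hp0
  have hgof (a) : g (AdjoinRoot.of p a) = noetherMap i K a := AdjoinRoot.lift_of ..
  have hginj : Function.Injective g := by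
    rw [injective_iff_map_eq_zero]
    intro q hq
    obtain ⟨q, rfl⟩ := AdjoinRoot.mk_surjective q
    rw [AdjoinRoot.mk_eq_zero]
    refine minpoly.isIntegrallyClosed_dvd hbint ?_
    exact (AdjoinRoot.lift_mk hp0 q).symm.trans hq
  have hgint : g.IsIntegral := by
    refine RingHom.IsIntegral.tower_top (AdjoinRoot.of p) g ?_
    have : g.comp (AdjoinRoot.of p) = noetherMap i K := RingHom.ext hgof
    rw [this]
    exact hN
  let e : AdjoinRoot p →+* ℂ := AdjoinRoot.lift (eval y) t (by rwa [← Polynomial.eval_map])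
  have heof (a) : e (AdjoinRoot.of p a) = eval y a := AdjoinRoot.lift_of ..
  have hemax : (RingHom.ker e).IsMaximal := by
    refine RingHom.ker_isMaximal_of_surjective e fun c => ⟨AdjoinRoot.of p (C c), ?_⟩
    rw [heof, eval_C]
  obtain ⟨Q, hQ, hQe⟩ : ∃ Q : Ideal (MvPolynomial (Fin n) ℂ ⧸ vanishingIdeal ℂ K),
      Q.IsMaximal ∧ Q.comap g = RingHom.ker e := by
    algebraize [g]
    refine Ideal.exists_ideal_over_maximal_of_isIntegral (RingHom.ker e) ?_
    exact ((RingHom.injective_iff_ker_eq_bot g).1 hginj).le.trans bot_le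
  have hmem (a) : g a ∈ Q ↔ e a = 0 := by
    rw [← RingHom.mem_ker, ← hQe, Ideal.mem_comap]
  have hQ' : (Q.comap (Ideal.Quotient.mk (vanishingIdeal ℂ K))).IsMaximal :=
    Ideal.comap_isMaximal_of_surjective _ Ideal.Quotient.mk_surjective
  obtain ⟨z, hz⟩ := isMaximal_iff_eq_vanishingIdeal_singleton.1 hQ'
  have hzmem (q : MvPolynomial (Fin n) ℂ) : Ideal.Quotient.mk _ q ∈ Q ↔ eval z q = 0 := by
    rw [← Ideal.mem_comap, hz, mem_vanishingIdeal_singleton_iff, aeval_eq_eval]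
  refine ⟨z, ?_, ?_, ?_⟩
  · rw [← zariskiClosure_of_isAlgebraicSet hK.1]
    intro q hq
    have := (hzmem q).1 (by rw [Ideal.Quotient.eq_zero_iff_mem.2 hq]; exact Q.zero_mem)
    simpa [aeval_eq_eval] using this
  · ext k
    have h1 : g (AdjoinRoot.of p (X k - C (y k))) ∈ Q := by
      rw [hmem, heof]; simp
    rw [hgof] at h1
    have h2 := (hzmem (X (k : Fin n) - C (y k))).1 (by simpa [noetherMap] using h1)
    simpa [sub_eq_zero, projC] using h2
  · have h1 : g (AdjoinRoot.root p - AdjoinRoot.of p (C t)) ∈ Q := by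
      rw [hmem, map_sub, heof, eval_C, sub_eq_zero]
      exact AdjoinRoot.lift_root ..
    have h3 : g (AdjoinRoot.root p) = Ideal.Quotient.mk _ h := AdjoinRoot.lift_root ..
    rw [map_sub, hgof, h3] at h1
    have h2 := (hzmem (h - C t)).1 (by simpa [noetherMap] using h1)
    simpa [sub_eq_zero] using h2

/-- A polynomial that separates a point from the other points of a finite set. -/
theorem exists_eval_eq_zero_of_finite {S : Set (Fin n → ℂ)} (hS : S.Finite) (x : Fin n → ℂ) :
    ∃ h : MvPolynomial (Fin n) ℂ, eval x h = 0 ∧ ∀ z ∈ S, eval z h = 0 → z = x := by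
  have key (z : Fin n → ℂ) : ∃ l : MvPolynomial (Fin n) ℂ, z ≠ x → eval x l = 1 ∧ eval z l = 0 := by
    by_cases hzx : z = x
    · exact ⟨0, fun h => absurd hzx h⟩
    · obtain ⟨j, hj⟩ := Function.ne_iff.1 hzx
      refine ⟨C (x j - z j)⁻¹ * (X j - C (z j)), fun _ => ⟨?_, ?_⟩⟩
      · simpa using inv_mul_cancel₀ (sub_ne_zero.2 (Ne.symm hj))
      · simp
  choose l hl using key
  classical
  refine ⟨1 - ∏ z ∈ hS.toFinset.erase x, l z, ?_, fun z hz h0 => ?_⟩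
  · rw [map_sub, map_one, map_prod, Finset.prod_eq_one, sub_self]
    exact fun z hz => (hl z (Finset.ne_of_mem_erase hz)).1
  · by_contra hzx
    rw [map_sub, map_one, map_prod, Finset.prod_eq_zero
      (Finset.mem_erase.2 ⟨hzx, hS.mem_toFinset.2 hz⟩) (hl z hzx).2] at h0
    simp at h0

/-- A monic complex polynomial has a root of size at most the `m`-th root of its constant
coefficient, because that coefficient is up to sign the product of the roots. -/
theorem exists_isRoot_norm_pow_le {p : Polynomial ℂ} (hp : p.Monic) (hdeg : p.natDegree ≠ 0) :
    ∃ t, p.IsRoot t ∧ ‖t‖ ^ p.natDegree ≤ ‖p.coeff 0‖ := by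
  have hs := IsAlgClosed.splits p
  have hcard := hs.natDegree_eq_card_roots
  have hne : p.roots.toFinset.Nonempty := by
    rw [Multiset.toFinset_nonempty]
    intro h
    rw [h, Multiset.card_zero] at hcard
    exact hdeg hcard
  obtain ⟨t, ht, hmin⟩ := Finset.exists_min_image p.roots.toFinset (fun u => ‖u‖) hne
  have key : ∀ s : Multiset ℂ, (∀ u ∈ s, ‖t‖ ≤ ‖u‖) → ‖t‖ ^ s.card ≤ ‖s.prod‖ := by
    intro s
    induction s using Multiset.induction_on with
    | empty => simp
    | cons a s ih =>
      intro h
      rw [Multiset.card_cons, Multiset.prod_cons, norm_mul, pow_succ']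
      exact mul_le_mul (h a (Multiset.mem_cons_self a s))
        (ih fun u hu => h u (Multiset.mem_cons_of_mem hu)) (by positivity) (norm_nonneg _)
  refine ⟨t, Polynomial.isRoot_of_mem_roots (Multiset.mem_toFinset.1 ht), ?_⟩
  rw [hs.coeff_zero_eq_prod_roots_of_monic hp, norm_mul, norm_pow, norm_neg, norm_one, one_pow,
    one_mul, hcard]
  exact key _ fun u hu => hmin u (Multiset.mem_toFinset.2 hu)

/-- The finite projection of an irreducible set of dimension `i` in Noether position is an open
map in the Euclidean topology. -/
theorem NoetherPosition.exists_mem_of_near {i : ℕ} {K : Set (Fin n → ℂ)}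
    (hK : IsIrreducibleAlgebraic K) (hN : NoetherPosition i K)
    (hd : (i : WithBot ℕ∞) ≤ dimension K) {x : Fin n → ℂ} (hx : x ∈ K) {ε : ℝ} (hε : 0 < ε) :
    ∃ δ > 0, ∀ y, dist y (projC i x) < δ → ∃ z ∈ K, dist z x < ε ∧ projC i z = y := by
  obtain ⟨h, hhx, hsep⟩ := exists_eval_eq_zero_of_finite (hN.finite_fiber (projC i x)) x
  obtain ⟨p, hp, hroot, hlift⟩ := hN.exists_monic_roots_eq hK hd h
  have hm : p.natDegree ≠ 0 := by
    intro h0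
    have := hroot x hx
    rw [(Polynomial.Monic.natDegree_eq_zero hp).1 h0] at this
    simp at this
  by_contra! hcon
  -- points `z k` over points `y k` tending to `π_i(x)`, with `h (z k)` tending to zero
  have hpos (k : ℕ) : (0 : ℝ) < 1 / ((k : ℝ) + 1) := Nat.one_div_pos_of_nat
  choose y hy hyfar using fun k => hcon _ (hpos k)
  have hyx : Filter.Tendsto y Filter.atTop (nhds (projC i x)) := by
    rw [tendsto_iff_dist_tendsto_zero]
    exact squeeze_zero (fun _ => dist_nonneg) (fun k => (hy k).le)
      tendsto_one_div_add_atTop_nhds_zero_nat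
  have hz : ∀ k, ∃ z ∈ K, projC i z = y k ∧
      ‖eval z h‖ ^ p.natDegree ≤ ‖eval (y k) (p.coeff 0)‖ := by
    intro k
    obtain ⟨t, ht, htn⟩ := exists_isRoot_norm_pow_le (hp.map (eval (y k)))
      (by rwa [hp.natDegree_map])
    obtain ⟨z, hzK, hzy, hzt⟩ := hlift _ t ht
    refine ⟨z, hzK, hzy, ?_⟩
    rwa [hp.natDegree_map, Polynomial.coeff_map, ← hzt] at htn
  choose z hzK hzy hzh using hz
  obtain ⟨B, hB⟩ := hN.exists_norm_le (‖projC i x‖ + 1)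
  have hbdd : ∀ k, z k ∈ Metric.closedBall (0 : Fin n → ℂ) B := by
    intro k
    rw [mem_closedBall_zero_iff]
    refine hB _ (hzK k) ?_
    rw [hzy]
    have h1 : dist (y k) (projC i x) ≤ 1 := (hy k).le.trans (by
      rw [div_le_one (by positivity)]; linarith [Nat.cast_nonneg (α := ℝ) k])
    have h2 := norm_le_norm_add_norm_sub' (y k) (projC i x)
    rw [dist_eq_norm] at h1
    linarith
  obtain ⟨w, -, φ, hφ, hw⟩ := (isCompact_closedBall (0 : Fin n → ℂ) B).tendsto_subseq hbdd
  have hwK : w ∈ K := hK.1.isClosed.mem_of_tendsto hw (Filter.Eventually.of_forall fun k => hzK _)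
  have hyφ := hyx.comp hφ.tendsto_atTop
  have hwy : projC i w = projC i x := by
    refine tendsto_nhds_unique (((continuous_projC i).tendsto w).comp hw) ?_
    refine hyφ.congr fun k => ?_
    simp [hzy]
  have hcoeff : eval (projC i x) (p.coeff 0) = 0 := by
    have := hroot x hx
    rwa [hhx, Polynomial.IsRoot, ← Polynomial.coeff_zero_eq_eval_zero, Polynomial.coeff_map] at this
  have hwh : eval w h = 0 := by
    have h1 : Filter.Tendsto (fun k => ‖eval (z (φ k)) h‖ ^ p.natDegree) Filter.atTop
        (nhds (‖eval w h‖ ^ p.natDegree)) :=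
      ((((MvPolynomial.continuous_eval h).tendsto w).comp hw).norm).pow _
    have h2 : Filter.Tendsto (fun k => ‖eval (y (φ k)) (p.coeff 0)‖) Filter.atTop (nhds 0) := by
      have := (((MvPolynomial.continuous_eval (p.coeff 0)).tendsto (projC i x)).comp hyφ).norm
      rwa [hcoeff, norm_zero] at this
    have h3 := le_of_tendsto_of_tendsto' h1 h2 fun k => hzh _
    have h4 : ‖eval w h‖ ^ p.natDegree = 0 := le_antisymm h3 (by positivity)
    simpa using pow_eq_zero_iff hm |>.1 h4
  have hwx : w = x := hsep w ⟨hwK, hwy⟩ hwh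
  subst hwx
  have hfar : ∀ k, ε ≤ dist (z (φ k)) w := by
    intro k
    by_contra! hlt
    exact hyfar _ _ (hzK _) hlt (hzy _)
  have := ge_of_tendsto' (tendsto_iff_dist_tendsto_zero.1 hw) hfar
  linarith

/-! ### The tangent space and the dimension of the Jacobian row space -/

/-- The linear form `v ↦ a ⬝ᵥ v`. -/
def dotCLM (a : Fin n → ℂ) : (Fin n → ℂ) →L[ℂ] ℂ :=
  LinearMap.toContinuousLinearMap (dotProductEquiv ℂ (Fin n) a)

@[simp]
theorem dotCLM_apply (a v : Fin n → ℂ) : dotCLM a v = a ⬝ᵥ v := rfl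

theorem hasStrictFDerivAt_eval (p : MvPolynomial (Fin n) ℂ) (x : Fin n → ℂ) :
    HasStrictFDerivAt (fun y => eval y p) (dotCLM (jacobianRow p x)) x := by
  induction p using MvPolynomial.induction_on with
  | C a =>
    simp only [eval_C]
    refine (hasStrictFDerivAt_const a x).congr_fderiv ?_
    ext v
    simp [jacobianRow, dotProduct]
  | add p q hp hq =>
    simp only [map_add]
    refine (hp.add hq).congr_fderiv ?_
    ext v
    simp [jacobianRow, dotProduct, add_mul, Finset.sum_add_distrib]
  | mul_X p j hp =>
    simp only [map_mul, eval_X]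
    refine (hp.mul (hasStrictFDerivAt_apply (𝕜 := ℂ) j x)).congr_fderiv ?_
    have h : jacobianRow (p * X j) x = Pi.single j (eval x p) + x j • jacobianRow p x := by
      ext k
      by_cases hk : k = j
      · subst hk; simp [jacobianRow]
      · simp [jacobianRow, pderiv_X, Ne.symm hk, hk]
    refine ContinuousLinearMap.ext fun v => ?_
    rw [dotCLM_apply, h, add_dotProduct, smul_dotProduct]
    simp

/-- If no nonzero vector of the Zariski tangent space of `U` at `x` is killed by the linear map
`L`, then `L` is antilipschitz on `U` near `x`: a limit of normalised secants violating this is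
tangent to `U` and killed by `L`. -/
theorem exists_norm_sub_le_of_tangent {E : Type*} [NormedAddCommGroup E] [NormedSpace ℂ E]
    (L : (Fin n → ℂ) →L[ℂ] E) (U : Set (Fin n → ℂ)) (x : Fin n → ℂ)
    (h : ∀ v, (∀ p ∈ vanishingIdeal ℂ U, jacobianRow p x ⬝ᵥ v = 0) → L v = 0 → v = 0) :
    ∃ ε > 0, ∃ c : NNReal, ∀ z ∈ U, ∀ w ∈ U, dist z x < ε → dist w x < ε →
      ‖z - w‖ ≤ c * ‖L z - L w‖ := by
  by_contra! hcon
  have hpos (k : ℕ) : (0 : ℝ) < 1 / ((k : ℝ) + 1) := Nat.one_div_pos_of_nat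
  choose z hz w hw hzx hwx hlt using fun k : ℕ => hcon _ (hpos k) (k + 1)
  have hne (k) : 0 < ‖z k - w k‖ := lt_of_le_of_lt (by positivity) (hlt k)
  let v : ℕ → Fin n → ℂ := fun k => ‖z k - w k‖⁻¹ • (z k - w k)
  have hv (k) : v k ∈ Metric.sphere (0 : Fin n → ℂ) 1 := by
    rw [mem_sphere_zero_iff_norm, norm_smul, norm_inv, norm_norm, inv_mul_cancel₀ (hne k).ne']
  have hLv (k) : ‖L (v k)‖ ≤ 1 / ((k : ℝ) + 1) := by
    have h1 : L (v k) = ‖z k - w k‖⁻¹ • (L (z k) - L (w k)) := by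
      rw [← map_sub]
      exact L.map_smul_of_tower _ _
    rw [h1, norm_smul, norm_inv, norm_norm, inv_mul_le_iff₀ (hne k), mul_one_div,
      le_div_iff₀ (by positivity), mul_comm]
    have := (hlt k).le
    push_cast at this
    exact this
  have htend {u : ℕ → Fin n → ℂ} (hu : ∀ k : ℕ, dist (u k) x < 1 / ((k : ℝ) + 1)) :
      Filter.Tendsto u Filter.atTop (nhds x) := by
    rw [tendsto_iff_dist_tendsto_zero]
    exact squeeze_zero (fun _ => dist_nonneg) (fun k => (hu k).le)
      tendsto_one_div_add_atTop_nhds_zero_nat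
  have hzw : Filter.Tendsto (fun k => (z k, w k)) Filter.atTop (nhds (x, x)) :=
    (htend hzx).prodMk_nhds (htend hwx)
  obtain ⟨v₀, hv₀, φ, hφ, hlim⟩ := (isCompact_sphere (0 : Fin n → ℂ) 1).tendsto_subseq hv
  have hv0 : v₀ = 0 := by
    refine h v₀ (fun p hp => ?_) ?_
    · have h1 := (hasStrictFDerivAt_eval p x).isLittleO.comp_tendsto hzw
      have h2 := h1.norm_right.tendsto_inv_smul_nhds_zero.comp hφ.tendsto_atTop
      have hU {u : Fin n → ℂ} (hu : u ∈ U) : eval u p = 0 := by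
        simpa [aeval_eq_eval] using hp u hu
      have h3 (k) : jacobianRow p x ⬝ᵥ v k = ‖z k - w k‖⁻¹ • (jacobianRow p x ⬝ᵥ (z k - w k)) :=
        dotProduct_smul _ _ _
      have h4 : Filter.Tendsto (fun k => jacobianRow p x ⬝ᵥ v (φ k)) Filter.atTop (nhds 0) := by
        have := h2.neg
        rw [neg_zero] at this
        refine this.congr fun k => ?_
        rw [h3]
        simp only [Function.comp_apply, hU (hz _), hU (hw _), dotCLM_apply]
        rw [sub_zero, zero_sub, smul_neg, neg_neg]
      have h5 : Filter.Tendsto (fun k => jacobianRow p x ⬝ᵥ v (φ k)) Filter.atTop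
          (nhds (jacobianRow p x ⬝ᵥ v₀)) := by
        have hc : Continuous fun u : Fin n → ℂ => jacobianRow p x ⬝ᵥ u := by
          unfold dotProduct; fun_prop
        exact (hc.tendsto v₀).comp hlim
      exact tendsto_nhds_unique h5 h4
    · have h1 : Filter.Tendsto (fun k => L (v (φ k))) Filter.atTop (nhds 0) := by
        have h0 : Filter.Tendsto (fun k => L (v k)) Filter.atTop (nhds 0) :=
          squeeze_zero_norm hLv tendsto_one_div_add_atTop_nhds_zero_nat
        exact h0.comp hφ.tendsto_atTop
      exact tendsto_nhds_unique ((L.continuous.tendsto v₀).comp hlim) h1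
  rw [hv0, mem_sphere_zero_iff_norm, norm_zero] at hv₀
  exact zero_ne_one hv₀

theorem dimension_le (V : Set (Fin n → ℂ)) : dimension V ≤ (n : WithBot ℕ∞) := by
  refine (ringKrullDim_quotient_le _).trans ?_
  rw [MvPolynomial.ringKrullDim_of_isNoetherianRing, ringKrullDim_eq_zero_of_field, zero_add,
    Nat.card_fin]

/-- The vectors orthogonal to the Jacobian row space, i.e. the Zariski tangent space, embed in a
linear space of dimension `n` minus the Jacobian rank. -/
theorem exists_linearMap_of_tangent (U : Set (Fin n → ℂ)) (x : Fin n → ℂ) :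
    ∃ (m : ℕ) (L : (Fin n → ℂ) →ₗ[ℂ] (Fin m → ℂ)),
      Module.finrank ℂ (jacobianRowSpace U x) + m = n ∧
      ∀ v, (∀ p ∈ vanishingIdeal ℂ U, jacobianRow p x ⬝ᵥ v = 0) → L v = 0 → v = 0 := by
  let J := (jacobianRowSpace U x).map (dotProductEquiv ℂ (Fin n)).toLinearMap
  let N : Submodule ℂ (Fin n → ℂ) := J.dualCoannihilator
  have hJ : Module.finrank ℂ J = Module.finrank ℂ (jacobianRowSpace U x) :=
    LinearEquiv.finrank_map_eq _ _
  have hsum := Subspace.finrank_add_finrank_dualCoannihilator_eq J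
  rw [hJ, Module.finrank_fin_fun] at hsum
  obtain ⟨P, hP⟩ := LinearMap.exists_leftInverse_of_injective N.subtype (Submodule.ker_subtype N)
  let e := (Module.finBasis ℂ N).equivFun
  refine ⟨Module.finrank ℂ N, e.toLinearMap ∘ₗ P, hsum, fun v hv hLv => ?_⟩
  have hvN : v ∈ N := by
    rw [Submodule.mem_dualCoannihilator]
    rintro _ ⟨w, hw, rfl⟩
    change w ⬝ᵥ v = 0
    refine Submodule.span_induction (p := fun w _ => w ⬝ᵥ v = 0) ?_ ?_ ?_ ?_ hw
    · rintro _ ⟨p, hp, rfl⟩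
      exact hv p hp
    · exact zero_dotProduct v
    · intro a b _ _ ha hb
      rw [add_dotProduct, ha, hb, add_zero]
    · intro c a _ ha
      rw [smul_dotProduct, ha, smul_zero]
  have h1 : P v = 0 := by simpa using hLv
  have h2 := LinearMap.congr_fun hP ⟨v, hvN⟩
  simp only [LinearMap.comp_apply, Submodule.subtype_apply, h1, LinearMap.id_apply] at h2
  exact (congrArg Subtype.val h2).symm

theorem card_subtype_fin_lt {i : ℕ} (h : i ≤ n) :
    Fintype.card {k : Fin n // (k : ℕ) < i} = i := by
  rw [Fintype.card_congr (Fin.castLEquiv h).symm, Fintype.card_fin]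

/-- The Jacobian rank is at most `n - i` at each point of an `i`-dimensional component. With a
larger rank the component would locally embed, by an antilipschitz map, in a space of
dimension less than `i`; this contradicts the openness of `π_i` on the component, by comparison
of Hausdorff dimensions. -/
theorem finrank_jacobianRowSpace_le {i : ℕ} {W : Set (Fin n → ℂ)} (hN : NoetherPosition i W)
    {x : Fin n → ℂ} (hx : x ∈ equidimComponent i W) :
    Module.finrank ℂ (jacobianRowSpace (equidimComponent i W) x) + i ≤ n := by
  obtain ⟨K, hK, hdK, hxK⟩ := id hx
  have hin : i ≤ n := by
    have := dimension_le K
    rw [hdK] at this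
    exact_mod_cast this
  have hKU : K ⊆ equidimComponent i W := fun y hy => ⟨K, hK, hdK, hy⟩
  obtain ⟨m, L, hm, hL⟩ := exists_linearMap_of_tangent (equidimComponent i W) x
  suffices i ≤ m by omega
  -- `L` embeds a neighbourhood of `x` in `K` into `ℂᵐ`, and `π_i` maps it onto an open set of `ℂⁱ`
  obtain ⟨ε, hε, c, hc⟩ := exists_norm_sub_le_of_tangent L.toContinuousLinearMap _ x hL
  obtain ⟨δ, hδ, hopen⟩ := (hN.mono hK.1.2).exists_mem_of_near hK.1.1 hdK.ge hxK hε
  let S := K ∩ Metric.ball x ε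
  have hinj : Set.InjOn L S := by
    intro z hz w hw hzw
    have := hc z (hKU hz.1) w (hKU hw.1) hz.2 hw.2
    rw [LinearMap.coe_toContinuousLinearMap', hzw, sub_self, norm_zero, mul_zero] at this
    exact sub_eq_zero.1 (norm_le_zero_iff.1 this)
  have hlip : LipschitzOnWith c (Function.invFunOn L S) (L '' S) := by
    refine LipschitzOnWith.of_dist_le_mul ?_
    rintro _ ⟨z, hz, rfl⟩ _ ⟨w, hw, rfl⟩
    rw [hinj.leftInvOn_invFunOn hz, hinj.leftInvOn_invFunOn hw, dist_eq_norm, dist_eq_norm]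
    exact hc z (hKU hz.1) w (hKU hw.1) hz.2 hw.2
  have hS : Function.invFunOn L S '' (L '' S) = S := hinj.leftInvOn_invFunOn.image_image
  have h1 : dimH S ≤ (2 * m : ℕ) := by
    calc dimH S = dimH (Function.invFunOn L S '' (L '' S)) := by rw [hS]
      _ ≤ dimH (L '' S) := hlip.dimH_image_le
      _ ≤ dimH (Set.univ : Set (Fin m → ℂ)) := dimH_mono (Set.subset_univ _)
      _ = (2 * m : ℕ) := by
        rw [Real.dimH_univ_eq_finrank, finrank_real_of_complex, Module.finrank_fin_fun]
  have hproj : LipschitzWith 1 (projC (n := n) i) := by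
    refine LipschitzWith.of_dist_le_mul fun z w => ?_
    rw [NNReal.coe_one, one_mul]
    exact (dist_pi_le_iff dist_nonneg).2 fun k => dist_le_pi_dist z w k
  have h2 : dimH (projC i '' S) ≤ dimH S := hproj.dimH_image_le S
  have h3 : projC i '' S ∈ nhds (projC i x) := by
    refine Metric.mem_nhds_iff.2 ⟨δ, hδ, fun y hy => ?_⟩
    obtain ⟨z, hz, hzx, hzy⟩ := hopen y hy
    exact ⟨z, ⟨hz, hzx⟩, hzy⟩
  have h4 := Real.dimH_of_mem_nhds h3
  rw [finrank_real_of_complex, Module.finrank_fintype_fun_eq_card, card_subtype_fin_lt hin] at h4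
  rw [h4] at h2
  have := h2.trans h1
  have : 2 * i ≤ 2 * m := by exact_mod_cast this
  omega

theorem exists_mul_eq_one_of_linearIndependent {K : Type*} [Field K] {m : ℕ}
    {G : Matrix (Fin m) (Fin n) K} (hG : LinearIndependent K G.row) :
    ∃ N : Matrix (Fin n) (Fin m) K, G * N = 1 := by
  obtain ⟨h, hh⟩ := LinearMap.exists_leftInverse_of_injective G.vecMulLinear
    (LinearMap.ker_eq_bot.2 (Matrix.vecMul_injective_iff.2 hG))
  refine ⟨(LinearMap.toMatrix' h).transpose, ?_⟩
  refine Matrix.ext_of_single_vecMul fun a => ?_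
  rw [← Matrix.vecMul_vecMul, Matrix.vecMul_transpose, LinearMap.toMatrix'_mulVec,
    Matrix.vecMul_one]
  exact LinearMap.congr_fun hh _

/-- The locus where the Jacobian rank is less than `m` is algebraic: it is cut out by the
determinants `det (G * N)`, where `G` is made of `m` gradients and `N` is constant. -/
theorem isAlgebraicSet_finrank_lt (U : Set (Fin n → ℂ)) (m : ℕ) :
    IsAlgebraicSet ℂ {x | Module.finrank ℂ (jacobianRowSpace U x) < m} := by
  let minor : (Fin m → MvPolynomial (Fin n) ℂ) → Matrix (Fin n) (Fin m) ℂ →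
      MvPolynomial (Fin n) ℂ := fun P N =>
    ((Matrix.of fun a k => pderiv k (P a) : Matrix (Fin m) (Fin n) (MvPolynomial (Fin n) ℂ)) *
      (N.map C : Matrix (Fin n) (Fin m) (MvPolynomial (Fin n) ℂ)) :
      Matrix (Fin m) (Fin m) (MvPolynomial (Fin n) ℂ)).det
  have hminor (P N) (x : Fin n → ℂ) : eval x (minor P N) =
      ((Matrix.of fun a => jacobianRow (P a) x) * N).det := by
    change eval x (Matrix.det _) = _
    rw [RingHom.map_det, RingHom.mapMatrix_apply, Matrix.map_mul]
    congr 2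
    ext a b
    simp
  refine ⟨Ideal.span {q | ∃ P N, (∀ a, P a ∈ vanishingIdeal ℂ U) ∧ q = minor P N}, ?_⟩
  ext x
  rw [zeroLocus_span]
  constructor
  · rintro hx _ ⟨P, N, hP, rfl⟩
    rw [aeval_eq_eval]
    change eval x _ = 0
    rw [hminor]
    by_contra hdet
    have hunit := (Matrix.isUnit_iff_isUnit_det _).2 (Ne.isUnit hdet)
    have hli : LinearIndependent ℂ (Matrix.of fun a => jacobianRow (P a) x).row := by
      rw [← Matrix.vecMul_injective_iff]
      have := Matrix.vecMul_injective_iff_isUnit.2 hunit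
      simp only [← Matrix.vecMul_vecMul] at this
      exact Function.Injective.of_comp (f := fun v => Matrix.vecMul v N) this
    have hsub : Submodule.span ℂ (Set.range (Matrix.of fun a => jacobianRow (P a) x).row) ≤
        jacobianRowSpace U x := by
      refine Submodule.span_mono ?_
      rintro _ ⟨a, rfl⟩
      exact ⟨P a, hP a, rfl⟩
    have h1 := Submodule.finrank_mono hsub
    rw [finrank_span_eq_card hli, Fintype.card_fin] at h1
    exact absurd hx (not_lt.2 h1)
  · intro hx
    by_contra hcon
    have hm : m ≤ Module.finrank ℂ (jacobianRowSpace U x) := not_lt.1 hcon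
    obtain ⟨f, hf, -, hli⟩ := Submodule.exists_fun_fin_finrank_span_eq ℂ
      ((fun p => jacobianRow p x) '' (vanishingIdeal ℂ U : Set (MvPolynomial (Fin n) ℂ)))
    choose P hP hPf using hf
    let P' : Fin m → MvPolynomial (Fin n) ℂ := fun a => P (Fin.castLE hm a)
    have hli' : LinearIndependent ℂ (Matrix.of fun a => jacobianRow (P' a) x).row := by
      have h1 := hli.comp (Fin.castLE hm) (Fin.castLE_injective hm)
      have h2 : (Matrix.of fun a => jacobianRow (P' a) x).row = f ∘ Fin.castLE hm :=
        funext fun a => hPf _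
      rw [h2]
      exact h1
    obtain ⟨N, hN⟩ := exists_mul_eq_one_of_linearIndependent hli'
    have := hx (minor P' N) ⟨P', N, fun a => hP _, rfl⟩
    rw [aeval_eq_eval] at this
    change eval x _ = 0 at this
    rw [hminor, hN, Matrix.det_one] at this
    exact one_ne_zero this

theorem isAlgebraicSet_singLocus {i : ℕ} {W : Set (Fin n → ℂ)} (hW : IsAlgebraicSet ℂ W)
    (hN : NoetherPosition i W) : IsAlgebraicSet ℂ (singLocus i (equidimComponent i W)) := by
  have h : singLocus i (equidimComponent i W) = equidimComponent i W ∩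
      {x | Module.finrank ℂ (jacobianRowSpace (equidimComponent i W) x) < n - i} := by
    ext x
    simp only [singLocus, regLocus, Set.mem_sdiff, Set.mem_ofPred_eq, Set.mem_inter_iff, not_and]
    refine and_congr_right fun hx => ?_
    have := finrank_jacobianRowSpace_le hN hx
    constructor
    · intro h1
      have := h1 hx
      omega
    · intro h1 _
      omega
  rw [h]
  exact (isAlgebraicSet_equidimComponent hW i).inter (isAlgebraicSet_finrank_lt _ _)

/-! ### The sets `𝒪_i` -/

theorem subset_cLocus_of_lt {i r : ℕ} (h : r < i) (V : Set (Fin n → ℂ)) :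
    equidimComponent r V ⊆ cLocus i V := fun _ hx =>
  subset_zariskiClosure _ (Or.inl ⟨r, h, hx⟩)

theorem cLocus_subset {i : ℕ} {V : Set (Fin n → ℂ)} (hV : IsAlgebraicSet ℂ V) :
    cLocus i V ⊆ V := by
  refine zariskiClosure_subset hV ?_
  rintro x (⟨r, -, hx⟩ | ⟨r, -, hx⟩)
  · exact equidimComponent_subset r V hx
  · exact equidimComponent_subset r V hx.1.1

theorem sLocus_subset (V : Set (Fin n → ℂ)) : sLocus V ⊆ V := by
  rintro x (⟨r, -, hx⟩ | ⟨r, -, hx⟩)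
  · exact equidimComponent_subset r V hx
  · exact equidimComponent_subset r V hx.1

/-- Although `𝒮(W)` is not defined as a closure, its union with `𝒞(π_i, W)` is closed. -/
theorem isAlgebraicSet_sLocus_union_cLocus {i : ℕ} {W : Set (Fin n → ℂ)}
    (hW : IsAlgebraicSet ℂ W) (hN : NoetherPosition i W) (hd : dimension W ≤ (i : WithBot ℕ∞)) :
    IsAlgebraicSet ℂ (sLocus W ∪ cLocus i W) := by
  by_cases hdi : dimension W = (i : WithBot ℕ∞)
  · have h : sLocus W ∪ cLocus i W = singLocus i (equidimComponent i W) ∪ cLocus i W := by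
      refine Set.Subset.antisymm (Set.union_subset ?_ Set.subset_union_right)
        (Set.union_subset_union_left _ fun x hx => Or.inr ⟨i, hdi, hx⟩)
      rintro x (⟨r, hr, hx⟩ | ⟨e, he, hx⟩)
      · rw [hdi] at hr
        exact Or.inr (subset_cLocus_of_lt (by exact_mod_cast hr) W hx)
      · rw [hdi] at he
        obtain rfl : i = e := by exact_mod_cast he
        exact Or.inl hx
    rw [h]
    exact (isAlgebraicSet_singLocus hW hN).union (isAlgebraicSet_zariskiClosure _)
  · have h : sLocus W ∪ cLocus i W = cLocus i W := by
      refine Set.union_eq_right.2 fun x hx => ?_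
      obtain ⟨r, hr, hxr⟩ := exists_mem_equidimComponent hW hd (sLocus_subset W hx)
      obtain ⟨K, hK, hKr, -⟩ := id hxr
      refine subset_cLocus_of_lt (lt_of_le_of_ne hr ?_) W hxr
      rintro rfl
      exact hdi (le_antisymm hd (hKr ▸ dimension_mono hK.1.2))
    rw [h]
    exact isAlgebraicSet_zariskiClosure _

/-- The sets `𝒪_i(V)` are algebraic subsets of `V`, as long as they have the dimension and the
Noether position that property `P` requires. -/
theorem isAlgebraicSet_oSet {d : ℕ} {V : Set (Fin n → ℂ)} (hV : IsAlgebraicSet ℂ V)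
    (hP : ∀ i ≤ d, dimension (oSet d V i) ≤ (i : WithBot ℕ∞) ∧ NoetherPosition i (oSet d V i))
    {i : ℕ} (hi : i ≤ d) : IsAlgebraicSet ℂ (oSet d V i) ∧ oSet d V i ⊆ V := by
  induction hi using Nat.decreasingInduction with
  | self => rw [oSet_self]; exact ⟨hV, subset_rfl⟩
  | of_succ i hi ih =>
    obtain ⟨halg, hsub⟩ := ih
    obtain ⟨hd, hN⟩ := hP (i + 1) hi
    rw [oSet_of_lt d V i hi]
    exact ⟨(isAlgebraicSet_sLocus_union_cLocus halg hN hd).union (isAlgebraicSet_zariskiClosure _),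
      Set.union_subset (Set.union_subset ((sLocus_subset _).trans hsub)
        ((cLocus_subset halg).trans hsub)) (cLocus_subset hV)⟩

theorem eq_zero_of_jacobianRowSpace_sup_eq_top {i : ℕ} {U : Set (Fin n → ℂ)} {x : Fin n → ℂ}
    (h : jacobianRowSpace U x ⊔ projRowSpace n i = ⊤) {v : Fin n → ℂ}
    (hv : ∀ p ∈ vanishingIdeal ℂ U, jacobianRow p x ⬝ᵥ v = 0) (hpv : projC i v = 0) : v = 0 := by
  rw [jacobianRowSpace, projRowSpace, ← Submodule.span_union] at h
  refine dotProduct_eq_zero v fun w => ?_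
  rw [dotProduct_comm]
  have hw : w ∈ (⊤ : Submodule ℂ (Fin n → ℂ)) := Submodule.mem_top
  rw [← h] at hw
  refine Submodule.span_induction (p := fun w _ => w ⬝ᵥ v = 0) ?_ ?_ ?_ ?_ hw
  · rintro _ (⟨p, hp, rfl⟩ | ⟨k, hk, rfl⟩)
    · exact hv p hp
    · rw [single_one_dotProduct]
      exact congrFun hpv ⟨k, hk⟩
  · exact zero_dotProduct v
  · intro a b _ _ ha hb
    rw [add_dotProduct, ha, hb, add_zero]
  · intro c a _ ha
    rw [smul_dotProduct, ha, smul_zero]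

/-- At a point of `W` outside `𝒮(W) ∪ 𝒞(π_i, W)`, the set `W` has a component of dimension `i`
and the gradients together with the differential of `π_i` span. -/
theorem regular_of_notMem {i : ℕ} {W : Set (Fin n → ℂ)} (hW : IsAlgebraicSet ℂ W)
    (hd : dimension W ≤ (i : WithBot ℕ∞)) {x : Fin n → ℂ} (hx : x ∈ W)
    (hs : x ∉ sLocus W) (hc : x ∉ cLocus i W) :
    x ∈ equidimComponent i W ∧
      jacobianRowSpace (equidimComponent i W) x ⊔ projRowSpace n i = ⊤ := by
  obtain ⟨r, hr, hxr⟩ := exists_mem_equidimComponent hW hd hx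
  obtain rfl : r = i := by
    by_contra hne
    exact hc (subset_cLocus_of_lt (lt_of_le_of_ne hr hne) W hxr)
  refine ⟨hxr, ?_⟩
  obtain ⟨K, hK, hKr, -⟩ := id hxr
  have hdim : dimension W = (r : WithBot ℕ∞) := le_antisymm hd (hKr ▸ dimension_mono hK.1.2)
  have hreg : x ∈ regLocus r (equidimComponent r W) := by
    by_contra hnr
    exact hs (Or.inr ⟨r, hdim, hxr, hnr⟩)
  have hcrit : x ∉ critLocus r r (equidimComponent r W) := fun h =>
    hc (subset_zariskiClosure _ (Or.inr ⟨r, le_rfl, h⟩))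
  have hge : n ≤ Module.finrank ℂ
      (jacobianRowSpace (equidimComponent r W) x ⊔ projRowSpace n r : Submodule ℂ _) := by
    by_contra! hlt
    exact hcrit ⟨hreg, by omega⟩
  refine Submodule.eq_top_of_finrank_eq (le_antisymm (Submodule.finrank_le _) ?_)
  rwa [Module.finrank_fin_fun]

/-! ### Real points -/

/-- The inclusion `ℝⁿ → ℂⁿ`. -/
def complexify (x : Fin n → ℝ) : Fin n → ℂ := fun k => (x k : ℂ)

theorem mem_realPoints {V : Set (Fin n → ℂ)} {x : Fin n → ℝ} :
    x ∈ realPoints V ↔ complexify x ∈ V := Iff.rfl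

theorem continuous_complexify : Continuous (complexify (n := n)) := by
  unfold complexify; fun_prop

theorem dist_complexify (x y : Fin n → ℝ) : dist (complexify x) (complexify y) = dist x y := by
  simp only [dist_pi_def, complexify]
  congr 2
  funext k
  exact NNReal.eq (by simp [← Complex.ofReal_sub, Complex.dist_eq, Real.dist_eq])

theorem norm_complexify (x : Fin n → ℝ) : ‖complexify x‖ = ‖x‖ := by
  have h := dist_complexify x 0
  have h0 : complexify (0 : Fin n → ℝ) = 0 := by ext; simp [complexify]
  rwa [h0, dist_zero_right, dist_zero_right] at h

theorem continuous_proj (i : ℕ) : Continuous (proj (n := n) i) := by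
  unfold proj; fun_prop

theorem projC_complexify (i : ℕ) (x : Fin n → ℝ) :
    projC i (complexify x) = fun k => (proj i x k : ℂ) := rfl

theorem norm_projC_complexify (i : ℕ) (x : Fin n → ℝ) :
    ‖projC i (complexify x)‖ = ‖proj i x‖ := by
  simp only [Pi.norm_def, projC_complexify]
  congr 2
  funext k
  exact NNReal.eq (by simp)

theorem isClosed_realPoints {V : Set (Fin n → ℂ)} (hV : IsAlgebraicSet ℂ V) :
    IsClosed (realPoints V) := hV.isClosed.preimage continuous_complexify

theorem isClosed_connectedComponentIn {X : Type*} [TopologicalSpace X] {S : Set X}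
    (hS : IsClosed S) (x : X) : IsClosed (connectedComponentIn S x) := by
  by_cases hx : x ∈ S
  · refine isClosed_of_closure_subset ?_
    exact isPreconnected_connectedComponentIn.closure.subset_connectedComponentIn
      (subset_closure (mem_connectedComponentIn hx))
      (hS.closure_subset_iff.2 (connectedComponentIn_subset S x))
  · rw [connectedComponentIn_eq_empty hx]
    exact isClosed_empty

/-- The real projection of a set in Noether position is a closed map. -/
theorem NoetherPosition.isClosed_image_proj {i : ℕ} {W : Set (Fin n → ℂ)}
    (hN : NoetherPosition i W) {F : Set (Fin n → ℝ)} (hF : IsClosed F) (hFW : F ⊆ realPoints W) :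
    IsClosed (proj i '' F) := by
  refine isClosed_of_closure_subset fun y hy => ?_
  obtain ⟨u, hu, huy⟩ := mem_closure_iff_seq_limit.1 hy
  choose x hxF hxu using hu
  obtain ⟨R, hR⟩ := huy.norm.bddAbove_range
  obtain ⟨B, hB⟩ := hN.exists_norm_le R
  have hbdd (k) : x k ∈ Metric.closedBall (0 : Fin n → ℝ) B := by
    rw [mem_closedBall_zero_iff, ← norm_complexify]
    refine hB _ (hFW (hxF k)) ?_
    rw [norm_projC_complexify, hxu]
    exact hR ⟨k, rfl⟩
  obtain ⟨w, -, φ, hφ, hw⟩ := (isCompact_closedBall (0 : Fin n → ℝ) B).tendsto_subseq hbdd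
  refine ⟨w, hF.mem_of_tendsto hw (Filter.Eventually.of_forall fun k => hxF _), ?_⟩
  refine tendsto_nhds_unique (((continuous_proj i).tendsto w).comp hw) ?_
  refine (huy.comp hφ.tendsto_atTop).congr fun k => ?_
  simp [hxu]

/-! ### The boundary of the projection of a connected component -/

/-- If `x ∈ C` lies on `W ⊆ V` at a regular point of `W` that is not critical for `π_i`, then
`π_i(C)` is a neighbourhood of `π_i(x)`. Near `x` the projection is injective and open on the
`i`-dimensional part of `W`; the unique preimage of a real point is real because `W` is stable
under conjugation. The real points so obtained form a compact set homeomorphic to a ball, hence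
they all lie on `C`. -/
theorem image_proj_mem_nhds {i : ℕ} {V W : Set (Fin n → ℂ)} (hWV : W ⊆ V)
    (hW : IsAlgebraicSet ℂ W) (hconj : conjSet W = W) (hN : NoetherPosition i W)
    (hd : dimension W ≤ (i : WithBot ℕ∞)) {C : Set (Fin n → ℝ)}
    (hC : IsConnectedComponentOf (realPoints V) C) {x : Fin n → ℝ} (hxC : x ∈ C)
    (hx : complexify x ∈ W) (hs : complexify x ∉ sLocus W) (hc : complexify x ∉ cLocus i W) :
    proj i '' C ∈ nhds (proj i x) := by
  obtain ⟨hxU, htop⟩ := regular_of_notMem hW hd hx hs hc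
  set U := equidimComponent i W with hU
  have hUconj : conjSet U = U := by rw [hU, ← equidimComponent_conjSet, hconj]
  have hUalg : IsAlgebraicSet ℂ U := isAlgebraicSet_equidimComponent hW i
  obtain ⟨K, hK, hdK, hxK⟩ := id hxU
  have hKU : K ⊆ U := fun y hy => ⟨K, hK, hdK, hy⟩
  let L : (Fin n → ℂ) →L[ℂ] ({k : Fin n // (k : ℕ) < i} → ℂ) :=
    ContinuousLinearMap.pi fun k => ContinuousLinearMap.proj (k : Fin n)
  have hL (z) : L z = projC i z := rfl
  obtain ⟨ε, hε, c, hinj⟩ := exists_norm_sub_le_of_tangent L U (complexify x)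
    fun v hv hLv => eq_zero_of_jacobianRowSpace_sup_eq_top htop hv hLv
  have hinj' : ∀ z ∈ U, ∀ w ∈ U, dist z (complexify x) < ε → dist w (complexify x) < ε →
      projC i z = projC i w → z = w := by
    intro z hz w hw hzx hwx hzw
    have h := hinj z hz w hw hzx hwx
    rw [hL, hL, hzw, sub_self, norm_zero, mul_zero] at h
    exact sub_eq_zero.1 (norm_le_zero_iff.1 h)
  obtain ⟨δ, hδ, hopen⟩ := (hN.mono hK.1.2).exists_mem_of_near hK.1.1 hdK.ge hxK (half_pos hε)
  let T : Set (Fin n → ℝ) := {z | complexify z ∈ U} ∩ Metric.closedBall x (ε / 2) ∩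
    proj i ⁻¹' Metric.closedBall (proj i x) (δ / 2)
  have hTlt {z} (hz : z ∈ T) : dist (complexify z) (complexify x) < ε := by
    rw [dist_complexify]
    exact lt_of_le_of_lt hz.1.2 (half_lt_self hε)
  have hTcompact : IsCompact T := by
    refine IsCompact.inter_right (IsCompact.inter_left (isCompact_closedBall _ _)
      (hUalg.isClosed.preimage continuous_complexify)) ?_
    exact Metric.isClosed_closedBall.preimage (continuous_proj i)
  have hTinj : Set.InjOn (proj i) T := by
    intro z hz w hw hzw
    have := hinj' _ hz.1.1 _ hw.1.1 (hTlt hz) (hTlt hw)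
      (by rw [projC_complexify, projC_complexify, hzw])
    funext k
    exact Complex.ofReal_injective (congrFun this k)
  have hTsurj : Metric.closedBall (proj i x) (δ / 2) ⊆ proj i '' T := by
    intro y hy
    have hdist : dist (fun k => (y k : ℂ)) (projC i (complexify x)) < δ := by
      refine lt_of_le_of_lt ?_ (lt_of_le_of_lt hy (half_lt_self hδ))
      refine (dist_pi_le_iff dist_nonneg).2 fun k => ?_
      refine le_trans (le_of_eq ?_) (dist_le_pi_dist y (proj i x) k)
      simp [projC, complexify, proj, ← Complex.ofReal_sub, Complex.dist_eq, Real.dist_eq]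
    obtain ⟨z, hzK, hzx, hzy⟩ := hopen _ hdist
    -- the conjugate of `z` lies over the same real point, so it is equal to `z`
    have hstarx : star (complexify x) = complexify x := by
      ext k; simp [complexify]
    have hzreal : star z = z := by
      refine hinj' _ ?_ _ (hKU hzK) ?_ (by linarith) ?_
      · rw [← mem_conjSet, hUconj]
        exact hKU hzK
      · rw [← hstarx, dist_star_star]
        linarith
      · funext k
        have := congrFun hzy k
        simp only [projC] at this ⊢
        rw [Pi.star_apply, this]
        simp
    let w : Fin n → ℝ := fun k => (z k).re
    have hw : complexify w = z := by
      funext k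
      exact Complex.conj_eq_iff_re.1 (congrFun hzreal k)
    have hwy : proj i w = y := by
      funext k
      have := congrFun hzy k
      simp only [projC] at this
      simp [proj, w, this]
    refine ⟨w, ⟨⟨?_, ?_⟩, ?_⟩, hwy⟩
    · change complexify w ∈ U
      rw [hw]
      exact hKU hzK
    · rw [Metric.mem_closedBall, ← dist_complexify, hw]
      exact hzx.le
    · change proj i w ∈ Metric.closedBall (proj i x) (δ / 2)
      rwa [hwy]
  have hTconn : IsPreconnected T := by
    have : CompactSpace T := isCompact_iff_compactSpace.1 hTcompact
    have hcont : Continuous fun z : T => proj i (z : Fin n → ℝ) :=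
      (continuous_proj i).comp continuous_subtype_val
    have h := (convex_closedBall (proj i x) (δ / 2)).isPreconnected.preimage_of_isClosedMap
      (f := fun z : T => proj i (z : Fin n → ℝ)) (fun z w h => Subtype.ext (hTinj z.2 w.2 h))
      hcont.isClosedMap (fun y hy => by
        obtain ⟨z, hz, hzy⟩ := hTsurj hy
        exact ⟨⟨z, hz⟩, hzy⟩)
    have h2 := h.image Subtype.val continuous_subtype_val.continuousOn
    convert h2
    ext z
    simp only [Set.mem_image, Set.mem_preimage, Subtype.exists, exists_and_right, exists_eq_right]
    exact ⟨fun hz => ⟨hz, hz.2⟩, fun ⟨hz, _⟩ => hz⟩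
  have hxT : x ∈ T := ⟨⟨hxU, Metric.mem_closedBall_self (half_pos hε).le⟩,
    Metric.mem_closedBall_self (half_pos hδ).le⟩
  have hTV : T ⊆ realPoints V := fun z hz => hWV (equidimComponent_subset i W hz.1.1)
  have hTC : T ⊆ C := by
    obtain ⟨x₀, -, rfl⟩ := hC
    rw [connectedComponentIn_eq hxC]
    exact hTconn.subset_connectedComponentIn hxT hTV
  exact Filter.mem_of_superset (Metric.closedBall_mem_nhds _ (half_pos hδ))
    (hTsurj.trans (Set.image_mono hTC))

/-- Descent of the boundary along a projection `r` with fibres the lines `h y`. If the boundary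
of `π' '' C` is contained in `π' '' D` and `π '' D` is closed, then over a point off `π '' D`
the set `π' '' C` contains either no point or the whole line. Near such a point `π '' C` is
therefore the preimage of `π' '' C` under the section `y ↦ h y 0`. -/
theorem frontier_image_subset_of_line {X E E' : Type*} [TopologicalSpace E] [TopologicalSpace E']
    {π : X → E} {π' : X → E'} {r : E' → E} (hr : ∀ x, r (π' x) = π x) {h : E → ℝ → E'}
    (hh : Continuous (Function.uncurry h)) (hrh : ∀ y t, r (h y t) = y)
    (hx : ∀ x, ∃ t, π' x = h (π x) t) {C D : Set X} (hfr : frontier (π' '' C) ⊆ π' '' D)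
    (hD : IsClosed (π '' D)) : frontier (π '' C) ⊆ π '' D := by
  have hmem {y t} (hy : h y t ∈ frontier (π' '' C)) : y ∈ π '' D := by
    obtain ⟨x, hxD, hxy⟩ := hfr hy
    exact ⟨x, hxD, by rw [← hr, hxy, hrh]⟩
  have hsection : π '' C ∩ (π '' D)ᶜ = (fun y => h y 0) ⁻¹' (π' '' C) ∩ (π '' D)ᶜ := by
    ext y
    refine and_congr_left fun hyD => ⟨?_, ?_⟩
    · rintro ⟨x, hxC, rfl⟩
      obtain ⟨t, ht⟩ := hx x
      have hcont : Continuous (h (π x)) := hh.comp (Continuous.prodMk_right (π x))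
      have hempty : frontier (h (π x) ⁻¹' (π' '' C)) = ∅ := by
        rw [Set.eq_empty_iff_forall_notMem]
        exact fun s hs => hyD (hmem (hcont.frontier_preimage_subset _ hs))
      rcases isClopen_iff.1 (isClopen_iff_frontier_eq_empty.2 hempty) with h0 | h0
      · have : t ∈ h (π x) ⁻¹' (π' '' C) := ⟨x, hxC, ht⟩
        rw [h0] at this
        exact this.elim
      · have : (0 : ℝ) ∈ h (π x) ⁻¹' (π' '' C) := h0 ▸ Set.mem_univ _
        exact this
    · rintro ⟨x, hxC, hxy⟩
      exact ⟨x, hxC, by rw [← hr, hxy, hrh]⟩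
  intro y hy
  by_contra hyD
  have hcont : Continuous fun y => h y 0 := hh.comp (Continuous.prodMk_left 0)
  have h1 : y ∈ frontier (π '' C) ∩ (π '' D)ᶜ := ⟨hy, hyD⟩
  rw [← frontier_inter_open_inter hD.isOpen_compl, hsection,
    frontier_inter_open_inter hD.isOpen_compl] at h1
  exact hyD (hmem (hcont.frontier_preimage_subset _ h1.1))

/-- The point of `ℝ^{i+1}` with first coordinates `y` and last coordinate `t`. -/
def appendCoord (i : ℕ) (y : {k : Fin n // (k : ℕ) < i} → ℝ) (t : ℝ) :
    {k : Fin n // (k : ℕ) < i + 1} → ℝ :=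
  fun k => if h : ((k : Fin n) : ℕ) < i then y ⟨k, h⟩ else t

theorem continuous_appendCoord (i : ℕ) :
    Continuous (Function.uncurry (appendCoord (n := n) i)) := by
  refine continuous_pi fun k => ?_
  by_cases h : ((k : Fin n) : ℕ) < i
  · simp only [Function.uncurry, appendCoord, h, dite_true]
    fun_prop
  · simp only [Function.uncurry, appendCoord, h, dite_false]
    fun_prop

theorem frontier_image_proj_subset_of_succ {i : ℕ} (hi : i < n) {C D : Set (Fin n → ℝ)}
    (hfr : frontier (proj (i + 1) '' C) ⊆ proj (i + 1) '' D) (hD : IsClosed (proj i '' D)) :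
    frontier (proj i '' C) ⊆ proj i '' D := by
  refine frontier_image_subset_of_line
    (r := fun y (k : {k : Fin n // (k : ℕ) < i}) => y ⟨k, Nat.lt_succ_of_lt k.2⟩)
    (fun x => rfl) (continuous_appendCoord i) (fun y t => ?_) (fun x => ⟨x ⟨i, hi⟩, ?_⟩) hfr hD
  · funext k
    simp [appendCoord, k.2]
  · funext k
    by_cases h : ((k : Fin n) : ℕ) < i
    · simp [appendCoord, proj, h]
    · have : (k : Fin n) = ⟨i, hi⟩ := Fin.ext (by have := k.2; simp only; omega)
      rw [appendCoord, dif_neg h, proj, this]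

/-- Properties `Q_i(V)` from the dimension and Noether position conditions, for an algebraic set
stable under complex conjugation. -/
theorem frontier_image_proj_subset {d : ℕ} (hdn : d ≤ n) {V : Set (Fin n → ℂ)}
    (hV : IsAlgebraicSet ℂ V) (hconj : conjSet V = V)
    (hP : ∀ i ≤ d, dimension (oSet d V i) ≤ (i : WithBot ℕ∞) ∧ NoetherPosition i (oSet d V i))
    {C : Set (Fin n → ℝ)} (hC : IsConnectedComponentOf (realPoints V) C) {i : ℕ} (hi : i < d) :
    frontier (proj (i + 1) '' C) ⊆ proj (i + 1) '' (realPoints (oSet d V i) ∩ C) := by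
  have hCclosed : IsClosed C := by
    obtain ⟨x, -, rfl⟩ := hC
    exact isClosed_connectedComponentIn (isClosed_realPoints hV) x
  have hCV : C ⊆ realPoints V := by
    obtain ⟨x, -, rfl⟩ := hC
    exact connectedComponentIn_subset _ _
  have hclosed {j : ℕ} (hj : j ≤ d) : IsClosed (proj j '' (realPoints (oSet d V j) ∩ C)) :=
    (hP j hj).2.isClosed_image_proj
      ((isClosed_realPoints (isAlgebraicSet_oSet hV hP hj).1).inter hCclosed)
      Set.inter_subset_left
  -- a boundary point with a preimage in `𝒪_{j+1} ∩ C` has this preimage in `𝒪_j`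
  have hstep {j : ℕ} (hj : j < d)
      (h : frontier (proj (j + 1) '' C) ⊆ proj (j + 1) '' (realPoints (oSet d V (j + 1)) ∩ C)) :
      frontier (proj (j + 1) '' C) ⊆ proj (j + 1) '' (realPoints (oSet d V j) ∩ C) := by
    intro y hy
    obtain ⟨x, ⟨hxO, hxC⟩, rfl⟩ := h hy
    refine ⟨x, ⟨?_, hxC⟩, rfl⟩
    by_contra hx
    rw [mem_realPoints, oSet_of_lt d V j hj, Set.mem_union, Set.mem_union, not_or, not_or] at hx
    obtain ⟨halg, hsub⟩ := isAlgebraicSet_oSet hV hP (Nat.succ_le_of_lt hj)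
    obtain ⟨hd, hN⟩ := hP (j + 1) hj
    have := image_proj_mem_nhds hsub halg (by rw [← oSet_conjSet, hconj]) hN hd hC hxC hxO
      hx.1.1 hx.1.2
    exact hy.2 (mem_interior_iff_mem_nhds.2 this)
  have hmain {j : ℕ} (hj : j ≤ d) :
      frontier (proj j '' C) ⊆ proj j '' (realPoints (oSet d V j) ∩ C) := by
    induction hj using Nat.decreasingInduction with
    | self =>
      have h := hclosed le_rfl
      rw [oSet_self, Set.inter_eq_right.2 hCV] at h ⊢
      exact h.frontier_subset
    | of_succ j hj ih =>
      exact frontier_image_proj_subset_of_succ (hj.trans_le hdn) (hstep hj ih) (hclosed hj.le)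
  exact hstep hi (hmain hi)

/-! ### Linear changes of variables over `ℚ` -/

theorem mem_invImage {M : GL (Fin n) ℂ} {Z : Set (Fin n → ℂ)} {x : Fin n → ℂ} :
    x ∈ invImage M Z ↔ (M : Matrix (Fin n) (Fin n) ℂ).mulVec x ∈ Z := by
  constructor
  · rintro ⟨z, hz, rfl⟩
    simpa [Matrix.mulVec_mulVec] using hz
  · intro h
    exact ⟨_, h, by simp [Matrix.mulVec_mulVec]⟩

theorem isAlgebraicSet_invImage {Z : Set (Fin n → ℂ)} (hZ : IsAlgebraicSet ℝ Z)
    (M : GL (Fin n) ℂ) : IsAlgebraicSet ℂ (invImage M Z) := by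
  obtain ⟨I, rfl⟩ := hZ
  let f : Fin n → MvPolynomial (Fin n) ℂ := fun k =>
    ∑ j, C ((M : Matrix (Fin n) (Fin n) ℂ) k j) * X j
  refine ⟨Ideal.span ((fun p : MvPolynomial (Fin n) ℝ => aeval f p) '' I), ?_⟩
  ext x
  have key (p : MvPolynomial (Fin n) ℝ) :
      aeval x (aeval f p) = aeval ((M : Matrix (Fin n) (Fin n) ℂ).mulVec x) p := by
    have h := MvPolynomial.comp_aeval_apply f ((aeval (R := ℂ) x).restrictScalars ℝ) p
    rw [AlgHom.restrictScalars_apply] at h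
    rw [h]
    congr 2
    funext k
    simp [f, Matrix.mulVec, dotProduct]
  rw [mem_invImage, zeroLocus_span]
  constructor
  · rintro h _ ⟨p, hp, rfl⟩
    exact (key p).trans (h p hp)
  · intro h p hp
    exact (key p).symm.trans (h _ ⟨p, hp, rfl⟩)

theorem conjSet_of_isAlgebraicSet_real {Z : Set (Fin n → ℂ)} (hZ : IsAlgebraicSet ℝ Z) :
    conjSet Z = Z := by
  obtain ⟨I, rfl⟩ := hZ
  ext x
  refine forall₂_congr fun p _ => ?_
  have h := MvPolynomial.comp_aeval_apply x (Complex.conjAe : ℂ →ₐ[ℝ] ℂ) p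
  have h2 : aeval (star x) p = star (aeval x p) := h.symm
  rw [h2, star_eq_zero]

theorem conjSet_invImage {Z : Set (Fin n → ℂ)} (hZ : conjSet Z = Z) {M : GL (Fin n) ℂ}
    (hM : ∀ a b, ∃ q : ℚ, (M : Matrix (Fin n) (Fin n) ℂ) a b = (q : ℂ)) :
    conjSet (invImage M Z) = invImage M Z := by
  ext x
  have h : (M : Matrix (Fin n) (Fin n) ℂ).mulVec (star x) =
      star ((M : Matrix (Fin n) (Fin n) ℂ).mulVec x) := by
    funext a
    simp only [Matrix.mulVec, dotProduct, Pi.star_apply, star_sum, star_mul']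
    refine Finset.sum_congr rfl fun b _ => ?_
    obtain ⟨q, hq⟩ := hM a b
    simp [hq]
  rw [mem_conjSet, mem_invImage, mem_invImage, h, ← mem_conjSet, hZ]

end PolarProj

end

theorem proposition5p2 (n d : ℕ) (Z : Set (Fin n → ℂ))
    (hZ : PolarProj.IsAlgebraicSet ℝ Z)
    (hd : PolarProj.dimension Z = (d : WithBot ℕ∞))
    (M : GL (Fin n) ℂ)
    (hM : ∀ a b : Fin n, ∃ q : ℚ, (M : Matrix (Fin n) (Fin n) ℂ) a b = (q : ℂ))
    (hP : PolarProj.PropertyP d Z M) :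
    ∀ i : ℕ, 1 ≤ i → i ≤ d →
      PolarProj.PropertyQ d (PolarProj.invImage M Z) i ∧
      ∀ C : Set (Fin n → ℝ),
        PolarProj.IsConnectedComponentOf
          (PolarProj.realPoints (PolarProj.invImage M Z)) C →
        IsClosed (PolarProj.proj i '' C) := by
  intro i hi1 hid
  have hdn : d ≤ n := by
    have := PolarProj.dimension_le Z
    rw [hd] at this
    exact_mod_cast this
  have hQ : PolarProj.PropertyQ d (PolarProj.invImage M Z) i := by
    intro C hC
    have := PolarProj.frontier_image_proj_subset hdn (PolarProj.isAlgebraicSet_invImage hZ M)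
      (PolarProj.conjSet_invImage (PolarProj.conjSet_of_isAlgebraicSet_real hZ) hM) hP hC
      (i := i - 1) (by omega)
    rwa [Nat.sub_add_cancel hi1] at this
  refine ⟨hQ, fun C hC => ?_⟩
  rw [← frontier_subset_iff_isClosed]
  exact (hQ C hC).trans (Set.image_mono Set.inter_subset_right)
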